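/- Conventions. Commutators are $[x,y]=x^{-1}y^{-1}xy$. Let $p$ be a prime and $i\ge 1$. A finite $p$-group $G$ is called semi-$p^i$-abelian if for all $x,y\in G$ one has $(xy)^{p^i}=1$ if and only if $x^{p^i}y^{p^i}=1$; it is called strongly semi-$p$-abelian if it is semi-$p^i$-abelian for every $i\ge 1$; and it is called inner semi-$p^2$-abelian if each of its proper subgroups is semi-$p^2$-abelian but $G$ itself is not. For every integer $n\ge 3$ let $G$ be the group generated by two elements $a_1,a_2$ subject to the following relations, in which $$b=[a_1,a_2],\qquad c_i=[b,a_i],\qquad d_{2i-2+j}=[c_i,a_j],\qquad e_{2r-2+j}=[d_r,a_j]\qquad (i,j\in\{1,2\},\ 1\le r\le 4):$$ $$a_1^{3^2}=a_2^{3^n}=b^{3^2}=c_1^{3}=c_2^{3^2}=d_r^{3}=e_v^{3}=1,\qquad [e_v,a_j]=1\qquad (1\le r\le 4,\ 1\le v\le 8,\ j\in\{1,2\}),$$ $$c_2^{3}=e_5,\qquad e_2e_3=1,\qquad e_1=e_4=1.$$ Then $G$ is a finite $3$-group in which $a_1$ has order $9$ and $a_2$ has order $3^n$. It is semi-$3$-abelian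 and inner semi-$9$-abelian: every proper subgroup of $G$ is semi-$9$-abelian, but $G$ is not semi-$9$-abelian. In particular $G$ is semi-$3$-abelian but not strongly semi-$3$-abelian. Consequently it is not true that every finite semi-$3$-abelian $3$-group is strongly semi-$3$-abelian, so for $p=3$ the answer to Xu's problem (for odd $p$, are semi-$p$-abelian $p$-groups strongly semi-$p$-abelian?) is negative. -/

import Mathlib

namespace SemiAbelian

/-- The power condition: `(ab)^m = 1` if and only if `a^m b^m = 1`, for all `a, b`. For a finite
`p`-group and `m = p ^ i` this says that the group is semi-`p ^ i`-abelian. -/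
def IsSemiAbelian (m : ℕ) (G : Type*) [Group G] : Prop :=
  ∀ a b : G, (a * b) ^ m = 1 ↔ a ^ m * b ^ m = 1

/-- Strongly semi-`p`-abelian: semi-`p ^ i`-abelian for all positive integers `i`. -/
def IsStronglySemiAbelian (p : ℕ) (G : Type*) [Group G] : Prop :=
  ∀ i : ℕ, 1 ≤ i → IsSemiAbelian (p ^ i) G

/-- Inner semi-`m`-abelian: every proper subgroup is semi-`m`-abelian, the group itself is not. -/
def IsInnerSemiAbelian (m : ℕ) (G : Type*) [Group G] : Prop :=
  (∀ H : Subgroup G, H ≠ ⊤ → IsSemiAbelian m H) ∧ ¬ IsSemiAbelian m G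

/-- The commutator `[x, y] = x⁻¹ y⁻¹ x y`. (Mathlib's `⁅x, y⁆` is `x y x⁻¹ y⁻¹`.) -/
def comm {G : Type*} [Group G] (x y : G) : G := x⁻¹ * y⁻¹ * x * y

/-- The free generators: `a 0` is `a₁` and `a 1` is `a₂`. All indices are shifted to start at `0`. -/
def a (i : Fin 2) : FreeGroup (Fin 2) := FreeGroup.of i

/-- `b = [a₁, a₂]`. -/
def b : FreeGroup (Fin 2) := comm (a 0) (a 1)

/-- `c 0, c 1` are `c₁, c₂`, where `cᵢ = [b, aᵢ]`. -/
def c (i : Fin 2) : FreeGroup (Fin 2) := comm b (a i)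

/-- `d 0 0, d 0 1, d 1 0, d 1 1` are `d₁, d₂, d₃, d₄`, where `d_{2i-2+j} = [cᵢ, aⱼ]`. -/
def d (i j : Fin 2) : FreeGroup (Fin 2) := comm (c i) (a j)

/-- `e 0 0 0, e 0 0 1, e 0 1 0, e 0 1 1, e 1 0 0, e 1 0 1, e 1 1 0, e 1 1 1` are `e₁, …, e₈`
in this order, where `e_{2r-2+j} = [d_r, aⱼ]`. -/
def e (i j k : Fin 2) : FreeGroup (Fin 2) := comm (d i j) (a k)

/-- The relators. The last four are `c₂³ = e₅`, `e₂ e₃ = 1`, `e₁ = 1` and `e₄ = 1`. -/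
def relators (n : ℕ) : Set (FreeGroup (Fin 2)) :=
  {a 0 ^ 3 ^ 2, a 1 ^ 3 ^ n, b ^ 3 ^ 2, c 0 ^ 3, c 1 ^ 3 ^ 2} ∪
  {w | ∃ i j, w = d i j ^ 3} ∪
  {w | ∃ i j k, w = e i j k ^ 3} ∪
  {w | ∃ i j k l, w = comm (e i j k) (a l)} ∪
  {c 1 ^ 3 * (e 1 0 0)⁻¹, e 0 0 1 * e 0 1 0, e 0 0 0, e 0 1 1}

/-- The group on two generators `a₁, a₂` subject to the above relators. -/
abbrev ExampleGroup (n : ℕ) : Type := PresentedGroup (relators n)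

end SemiAbelian

/-! Put `norm₃ y z` = z^{y²} z^y z. Since (yz)³ = y³ · `norm₃ y z`, the group is semi-3-abelian
exactly when, for each z, the vanishing of `norm₃ y z` does not depend on y (y = 1 gives z³).

Commutator calculus (`Rel.sys`) produces an abelian normal subgroup `K`, generated by a₁³, b³ and
all the c, d, e, and an elementary abelian normal subgroup `K₀`, where c₂ is left out of the
generators. Put ε = e₅, η = e₇, θ = e₈. On `K` the norm is multiplicative in z. It kills `K₀`: the
relations e₁ = e₄ = e₂e₃ = 1 remove the quadratic terms that c₁ would contribute. It sends c₂ to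
ε^{1+i²}η^uθ^v, where i is the a₁-exponent of y and the 1 comes from c₂³ = ε (`norm₃_K`). As -1 is
not a square mod 3, the exponent 1+i² is never divisible by 3. With abelian and Heisenberg quotients
for the other exponents, `norm₃ y z` = 1 forces z = ζw with w in `K₀`, ζ central and ζ³ = 1
(`exists_of_norm₃_eq_one`). This condition does not involve y and implies that all norms of z
vanish.

If x has exponents i, j in a₁, a₂, then x³ is a₂^{3j}c₂^{ij²} modulo `K₀`, as the quotient C₃ ≀ C₃
shows, so x⁹ = a₂^{9j}ε^{ij²} (`pow_nine_normal_form`). For x = a₁a₂⁻¹ and y = a₂ this gives (xy)⁹ =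
1 but x⁹y⁹ = ε. In a proper subgroup the pairs (i, j) mod 3 lie on a line through the origin, and
there the odd form ij² does no harm.

Finally ε ≠ 1, by an explicit monomial representation on 27 points with coefficients in ℤ/9
(`rel_mono`). -/

namespace SemiAbelian

/-! ### Commutator words and the defining relations. -/

section Words
variable {G H : Type*} [Group G] [Group H]

/-- Conjugation `x ↦ g⁻¹ x g`. -/
def cj (g : G) : G →* G := (MulAut.conj g⁻¹).toMonoidHom

theorem cj_apply (g x : G) : cj g x = g⁻¹ * x * g := by simp [cj]

theorem cj_mul_left (g h x : G) : cj (g * h) x = cj h (cj g x) := by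
  simp [cj_apply, mul_assoc]

theorem cj_one_left (x : G) : cj (1 : G) x = x := by simp [cj_apply]

theorem cj_self (x : G) : cj x x = x := by simp [cj_apply]

theorem cj_comm (g x : G) : cj g x = x * comm x g := by simp [cj_apply, comm, mul_assoc]

theorem cj_eq_iff {g x : G} : cj g x = x ↔ Commute g x := by
  rw [cj_apply, mul_assoc, inv_mul_eq_iff_eq_mul, eq_comm]; rfl

theorem cj_of_commute {g x : G} (h : Commute g x) : cj g x = x := cj_eq_iff.2 h

theorem map_cj (f : G →* H) (g x : G) : f (cj g x) = cj (f g) (f x) := by simp [cj_apply]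

theorem map_comm (f : G →* H) (x y : G) : f (comm x y) = comm (f x) (f y) := by simp [comm]

theorem comm_eq_one_iff {x y : G} : comm x y = 1 ↔ Commute x y := by
  rw [← mul_eq_left (a := x), ← cj_comm, cj_eq_iff]
  exact ⟨Commute.symm, Commute.symm⟩

theorem comm_eq_of_mul_eq {x y z : G} (h : x * y = y * x * z) : comm x y = z := by
  rw [comm, mul_assoc, h]; group

/-- The value of the word `b` at a pair of elements. -/
def wb (g : Fin 2 → G) : G := comm (g 0) (g 1)

/-- The values of the words `cᵢ` at a pair of elements. -/
def wc (g : Fin 2 → G) (i : Fin 2) : G := comm (wb g) (g i)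

/-- The values of the words `d` at a pair of elements. -/
def wd (g : Fin 2 → G) (i j : Fin 2) : G := comm (wc g i) (g j)

/-- The values of the words `e` at a pair of elements. -/
def we (g : Fin 2 → G) (i j k : Fin 2) : G := comm (wd g i j) (g k)

/-- The pair `g` satisfies the defining relations of `ExampleGroup n`. -/
structure Rel (n : ℕ) (g : Fin 2 → G) : Prop where
  a0 : g 0 ^ 3 ^ 2 = 1
  a1 : g 1 ^ 3 ^ n = 1
  b : wb g ^ 3 ^ 2 = 1
  c0 : wc g 0 ^ 3 = 1
  c1 : wc g 1 ^ 3 ^ 2 = 1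
  d : ∀ i j, wd g i j ^ 3 = 1
  e : ∀ i j k, we g i j k ^ 3 = 1
  central : ∀ i j k l, comm (we g i j k) (g l) = 1
  c1e : wc g 1 ^ 3 = we g 1 0 0
  e12 : we g 0 0 1 * we g 0 1 0 = 1
  e0 : we g 0 0 0 = 1
  e3 : we g 0 1 1 = 1

theorem map_b (f : FreeGroup (Fin 2) →* G) : f b = wb (f ∘ a) := by
  simp [b, wb, map_comm]

theorem map_c (f : FreeGroup (Fin 2) →* G) (i) : f (c i) = wc (f ∘ a) i := by
  simp [c, wc, map_comm, map_b]

theorem map_d (f : FreeGroup (Fin 2) →* G) (i j) : f (d i j) = wd (f ∘ a) i j := by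
  simp [d, wd, map_comm, map_c]

theorem map_e (f : FreeGroup (Fin 2) →* G) (i j k) : f (e i j k) = we (f ∘ a) i j k := by
  simp [e, we, map_comm, map_d]

theorem rel_iff_map_relators (n : ℕ) (f : FreeGroup (Fin 2) →* G) :
    Rel n (f ∘ a) ↔ ∀ r ∈ relators n, f r = 1 := by
  constructor
  · intro h r hr
    rcases hr with (((hr | ⟨i, j, rfl⟩) | ⟨i, j, k, rfl⟩) | ⟨i, j, k, l, rfl⟩) | hr
    · rcases hr with rfl | rfl | rfl | rfl | rfl
      · simpa using h.a0
      · simpa using h.a1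
      · simpa [map_b] using h.b
      · simpa [map_c] using h.c0
      · simpa [map_c] using h.c1
    · simpa [map_d] using h.d i j
    · simpa [map_e] using h.e i j k
    · simpa [map_comm, map_e] using h.central i j k l
    · rcases hr with rfl | rfl | rfl | rfl
      · simpa [map_c, map_e, mul_inv_eq_one] using h.c1e
      · simpa [map_e] using h.e12
      · simpa [map_e] using h.e0
      · simpa [map_e] using h.e3
  · intro h
    have h₁ : ∀ r ∈ ({a 0 ^ 3 ^ 2, a 1 ^ 3 ^ n, b ^ 3 ^ 2, c 0 ^ 3, c 1 ^ 3 ^ 2} :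
        Set (FreeGroup (Fin 2))), f r = 1 := fun r hr =>
      h r (Or.inl (Or.inl (Or.inl (Or.inl hr))))
    have h₂ : ∀ r ∈ ({c 1 ^ 3 * (e 1 0 0)⁻¹, e 0 0 1 * e 0 1 0, e 0 0 0, e 0 1 1} :
        Set (FreeGroup (Fin 2))), f r = 1 := fun r hr => h r (Or.inr hr)
    have hd (i j) : f (d i j ^ 3) = 1 := h _ (Or.inl (Or.inl (Or.inl (Or.inr ⟨i, j, rfl⟩))))
    have he (i j k) : f (e i j k ^ 3) = 1 := h _ (Or.inl (Or.inl (Or.inr ⟨i, j, k, rfl⟩)))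
    have hc (i j k l) : f (comm (e i j k) (a l)) = 1 := h _ (Or.inl (Or.inr ⟨i, j, k, l, rfl⟩))
    simp only [Set.mem_insert_iff, Set.mem_singleton_iff, forall_eq_or_imp, forall_eq, map_pow,
      map_mul, map_inv, map_b, map_c, map_d, map_e, map_comm, mul_inv_eq_one] at h₁ h₂ hd he hc
    obtain ⟨p1, p2, p3, p4, p5⟩ := h₁
    obtain ⟨q1, q2, q3, q4⟩ := h₂
    exact ⟨p1, p2, p3, p4, p5, hd, he, hc, q1, q2, q3, q4⟩

theorem rel_of (n : ℕ) : Rel n (PresentedGroup.of : Fin 2 → ExampleGroup n) :=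
  (rel_iff_map_relators n (PresentedGroup.mk (relators n))).2
    fun _ hr => PresentedGroup.one_of_mem hr

theorem Rel.exists_hom {n : ℕ} {g : Fin 2 → G} (h : Rel n g) :
    ∃ φ : ExampleGroup n →* G, ∀ i, φ (PresentedGroup.of i) = g i := by
  have hg : g = FreeGroup.lift g ∘ a := by ext i; simp [a]
  rw [hg] at h
  exact ⟨PresentedGroup.toGroup ((rel_iff_map_relators n _).1 h), fun i => PresentedGroup.toGroup.of _⟩

end Words

/-! ### Commutator calculus forced by the relations. -/

section Collection
variable {n : ℕ} {G : Type*} [Group G] {g : Fin 2 → G}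

theorem commute_of_gen (hg : Subgroup.closure (Set.range g) = ⊤) {x : G}
    (h : ∀ i, Commute (g i) x) (y : G) : Commute y x := by
  have hy : y ∈ Subgroup.closure (Set.range g) := hg ▸ Subgroup.mem_top y
  induction hy using Subgroup.closure_induction with
  | mem y hy => obtain ⟨i, rfl⟩ := hy; exact h i
  | one => exact Commute.one_left x
  | mul y z _ _ hy hz => exact hy.mul_left hz
  | inv y _ hy => exact hy.inv_left

theorem cj_gen_wb (i) : cj (g i) (wb g) = wb g * wc g i := cj_comm _ _
theorem cj_gen_wc (i j) : cj (g j) (wc g i) = wc g i * wd g i j := cj_comm _ _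
theorem cj_gen_wd (i j k) : cj (g k) (wd g i j) = wd g i j * we g i j k := cj_comm _ _

theorem gen_mul_gen : g 0 * g 1 = g 1 * g 0 * wb g := by simp [wb, comm, mul_assoc]

/-- Both sides of a₁a₂ = a₂a₁b act in the same way. Once the actions of a₁ and a₂ on x are known,
this determines that of b; it is applied to the d, the c and b itself. -/
theorem cj_wb (x : G) : cj (wb g) (cj (g 0) (cj (g 1) x)) = cj (g 1) (cj (g 0) x) := by
  simp only [← cj_mul_left, ← gen_mul_gen]

variable (h : Rel n g) (hg : Subgroup.closure (Set.range g) = ⊤)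
include h hg

theorem Rel.commute_we (i j k : Fin 2) (y : G) : Commute y (we g i j k) :=
  commute_of_gen hg (fun l => (comm_eq_one_iff.1 (h.central i j k l)).symm) y

theorem Rel.cj_we (i j k : Fin 2) (y : G) : cj y (we g i j k) = we g i j k :=
  cj_of_commute (h.commute_we hg i j k y)

theorem Rel.commute_wb_wd (i j : Fin 2) : Commute (wb g) (wd g i j) := by
  rw [← cj_eq_iff]
  have := cj_wb (g := g) (wd g i j)
  simp only [cj_gen_wd, map_mul, h.cj_we hg] at this
  rw [mul_assoc, mul_assoc, (h.commute_we hg i j 1 (we g i j 0)).eq] at this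
  exact mul_right_cancel this

/-- A generator moves each d only by a central factor, so the centralizer of the d is stable under
conjugation by generators. Hence commuting with the d passes from b to c_l = b⁻¹b^{a_l}, and from
there to the d. -/
theorem Rel.commute_cj_wd {x : G} (hx : ∀ i j, Commute x (wd g i j)) (i j k : Fin 2) :
    Commute (cj (g k) x) (wd g i j) := by
  have := (hx i j).map (cj (g k))
  rw [cj_gen_wd] at this
  simpa using this.mul_right (h.commute_we hg i j k (cj (g k) x)).inv_right

theorem Rel.commute_wc_wd (l i j : Fin 2) : Commute (wc g l) (wd g i j) := by
  have : wc g l = (wb g)⁻¹ * cj (g l) (wb g) := by simp [cj_gen_wb]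
  rw [this]
  exact (h.commute_wb_wd hg i j).inv_left.mul_left
    (h.commute_cj_wd hg (h.commute_wb_wd hg) i j l)

theorem Rel.commute_wd_wd (l m i j : Fin 2) : Commute (wd g l m) (wd g i j) := by
  have : wd g l m = (wc g l)⁻¹ * cj (g m) (wc g l) := by simp [cj_gen_wc]
  rw [this]
  exact (h.commute_wc_wd hg l i j).inv_left.mul_left
    (h.commute_cj_wd hg (h.commute_wc_wd hg l) i j m)

theorem Rel.cj_wb_wc (i : Fin 2) :
    cj (wb g) (wc g i) = wc g i * (we g i 0 1 * (we g i 1 0)⁻¹) := by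
  have := cj_wb (g := g) (wc g i)
  simp only [cj_gen_wc, cj_gen_wd, map_mul, h.cj_we hg,
    cj_of_commute (h.commute_wb_wd hg _ _)] at this
  have e1 := (h.commute_we hg i 0 1)
  have e2 := (h.commute_we hg i 1 0)
  have e3 := h.commute_wd_wd hg i 0 i 1
  rw [← mul_assoc, eq_mul_inv_iff_mul_eq]
  apply mul_right_cancel (b := wd g i 0 * wd g i 1)
  have this' : cj (wb g) (wc g i) * (wd g i 0 * wd g i 1) * we g i 1 0 =
      wc g i * (wd g i 1 * wd g i 0) * we g i 0 1 := by simpa only [mul_assoc] using this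
  rw [← (e2 (wd g i 0 * wd g i 1)).right_comm, this', ← e3.eq, (e1 _).right_comm]

/-- Both b and b^{a_j} = b c_j multiply c_i by the same central element u, so c_j centralizes c_i.
-/
theorem Rel.commute_wc_wc (i j : Fin 2) : Commute (wc g j) (wc g i) := by
  have hd (k l) := h.commute_wb_wd hg k l
  set u := we g i 0 1 * (we g i 1 0)⁻¹ with hu
  have hb : cj (wb g) (wc g i) = wc g i * u := h.cj_wb_wc hg i
  have hu' (y : G) : Commute y u :=
    (h.commute_we hg _ _ _ y).mul_right (h.commute_we hg _ _ _ y).inv_right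
  -- The preimage of c_i under conjugation by a_j; b multiplies it by u as well, because it differs
  -- from c_i by elements that commute with b.
  set c' := wc g i * (wd g i j)⁻¹ * we g i j j
  have hc' : cj (g j) c' = wc g i := by
    simp only [c', map_mul, map_inv, cj_gen_wc, cj_gen_wd, h.cj_we hg]
    simp [mul_assoc, ((h.commute_we hg i j j ((wd g i j)⁻¹))).eq]
  have hbc' : cj (wb g) c' = c' * u := by
    simp only [c', map_mul, map_inv, hb, cj_of_commute (hd _ _), h.cj_we hg]
    rw [(hu' (we g i j j)).right_comm, (hu' ((wd g i j)⁻¹)).right_comm]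
  have key : cj (cj (g j) (wb g)) (wc g i) = wc g i * u := by
    have : cj (cj (g j) (wb g)) (cj (g j) c') = cj (g j) (cj (wb g) c') := by
      simp [cj_apply, mul_assoc]
    rw [hc', hbc', map_mul, hc', cj_of_commute (hu' _)] at this
    exact this
  rw [← cj_eq_iff]
  rw [cj_gen_wb, cj_mul_left, hb, map_mul, cj_of_commute (hu' _)] at key
  exact mul_right_cancel key

/-- This is `cj_wb` at x = b: the two orders of conjugation agree only if d₂ and d₃ agree up to
central factors. Consequently e₃ = e₅ and e₄ = e₆. -/
theorem Rel.wd_zero_one :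
    wd g 0 1 = wd g 1 0 * (we g 0 0 1 * (we g 0 1 0)⁻¹) * (we g 1 0 1 * (we g 1 1 0)⁻¹) := by
  have := cj_wb (g := g) (wb g)
  simp only [cj_gen_wb, cj_gen_wc, cj_self, map_mul, h.cj_wb_wc hg,
    cj_of_commute (h.commute_wb_wd hg _ _)] at this
  set u := we g 0 0 1 * (we g 0 1 0)⁻¹
  set v := we g 1 0 1 * (we g 1 1 0)⁻¹
  have hu (y : G) : Commute y u :=
    (h.commute_we hg _ _ _ y).mul_right (h.commute_we hg _ _ _ y).inv_right
  have hv (y : G) : Commute y v :=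
    (h.commute_we hg _ _ _ y).mul_right (h.commute_we hg _ _ _ y).inv_right
  have hc := h.commute_wc_wc hg 0 1
  simp only [mul_assoc (wb g)] at this
  rw [mul_left_cancel_iff, hc.left_comm] at this
  have h2 : wc g 0 * u * (wc g 1 * v * wd g 1 0) = wc g 0 * (wc g 1 * (wd g 1 0 * u * v)) := by
    rw [mul_assoc (wc g 0), ← (hu (wc g 1 * v * wd g 1 0)).eq,
      mul_assoc (wc g 1), ← (hv (wd g 1 0)).eq]
    simp only [mul_assoc]
    rw [(hu v).eq]
  rw [h2] at this
  exact (mul_left_cancel (mul_left_cancel this)).symm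

theorem Rel.we_zero_one (k : Fin 2) : we g 0 1 k = we g 1 0 k := by
  set z := (we g 0 0 1 * (we g 0 1 0)⁻¹) * (we g 1 0 1 * (we g 1 1 0)⁻¹)
  have hz (y : G) : Commute y z := by
    refine Commute.mul_right (Commute.mul_right ?_ ?_) (Commute.mul_right ?_ ?_) <;>
    simp [h.commute_we hg _ _ _ y]
  have h1 : wd g 0 1 = wd g 1 0 * z := by rw [h.wd_zero_one hg, mul_assoc]
  have h2 : cj (g k) (wd g 0 1) = cj (g k) (wd g 1 0 * z) := by rw [h1]
  rw [map_mul, cj_of_commute (hz _), cj_gen_wd, cj_gen_wd, h1, (hz _).right_comm] at h2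
  exact mul_left_cancel h2

end Collection

/-- The consequences of the relations in a group generated by `a₁, a₂`, with
`ε = e₃ = e₅ = e₂⁻¹`, `η = e₇` and `θ = e₈`. -/
structure Sys (n : ℕ) (G : Type*) [Group G] where
  (a₁ a₂ b c₁ c₂ d₁ d₂ d₃ d₄ ε η θ : G)
  gen : Subgroup.closure {a₁, a₂} = ⊤
  a₁_pow : a₁ ^ 9 = 1
  a₂_pow : a₂ ^ 3 ^ n = 1
  b_pow : b ^ 9 = 1
  c₁_pow : c₁ ^ 3 = 1
  c₂_pow : c₂ ^ 3 = ε
  d₁_pow : d₁ ^ 3 = 1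
  d₂_pow : d₂ ^ 3 = 1
  d₃_pow : d₃ ^ 3 = 1
  d₄_pow : d₄ ^ 3 = 1
  ε_pow : ε ^ 3 = 1
  η_pow : η ^ 3 = 1
  θ_pow : θ ^ 3 = 1
  hε : ∀ y, Commute y ε
  hη : ∀ y, Commute y η
  hθ : ∀ y, Commute y θ
  a₁_a₂ : cj a₂ a₁ = a₁ * b
  b_a₁ : cj a₁ b = b * c₁
  b_a₂ : cj a₂ b = b * c₂
  c₁_a₁ : cj a₁ c₁ = c₁ * d₁
  c₁_a₂ : cj a₂ c₁ = c₁ * d₂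
  c₂_a₁ : cj a₁ c₂ = c₂ * d₃
  c₂_a₂ : cj a₂ c₂ = c₂ * d₄
  d₁_a₁ : cj a₁ d₁ = d₁
  d₁_a₂ : cj a₂ d₁ = d₁ * ε⁻¹
  d₂_a₁ : cj a₁ d₂ = d₂ * ε
  d₂_a₂ : cj a₂ d₂ = d₂
  d₃_a₁ : cj a₁ d₃ = d₃ * ε
  d₃_a₂ : cj a₂ d₃ = d₃
  d₄_a₁ : cj a₁ d₄ = d₄ * η
  d₄_a₂ : cj a₂ d₄ = d₄ * θ
  c₁_b : cj b c₁ = c₁ * ε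
  c₂_b : cj b c₂ = c₂ * η⁻¹
  c₁_c₂ : Commute c₁ c₂
  d₁_b : Commute b d₁
  d₂_b : Commute b d₂
  d₃_b : Commute b d₃
  d₄_b : Commute b d₄
  d₁_c₁ : Commute c₁ d₁
  d₂_c₁ : Commute c₁ d₂
  d₃_c₁ : Commute c₁ d₃
  d₄_c₁ : Commute c₁ d₄
  d₁_c₂ : Commute c₂ d₁
  d₂_c₂ : Commute c₂ d₂
  d₃_c₂ : Commute c₂ d₃
  d₄_c₂ : Commute c₂ d₄
  d₁_d₂ : Commute d₁ d₂
  d₁_d₃ : Commute d₁ d₃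
  d₁_d₄ : Commute d₁ d₄
  d₂_d₃ : Commute d₂ d₃
  d₂_d₄ : Commute d₂ d₄
  d₃_d₄ : Commute d₃ d₄

/-- A generating pair that satisfies the relations gives the collected data. -/
def Rel.sys {n : ℕ} {G : Type*} [Group G] {g : Fin 2 → G} (h : Rel n g)
    (hg : Subgroup.closure (Set.range g) = ⊤) : Sys n G :=
  have h5 : we g 0 1 0 = we g 1 0 0 := h.we_zero_one hg 0
  have h2 : we g 0 0 1 = (we g 1 0 0)⁻¹ := by rw [← h5]; exact eq_inv_of_mul_eq_one_left h.e12
  have h6 : we g 1 0 1 = 1 := by rw [← h.we_zero_one hg 1, h.e3]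
  have hb (i j) := h.commute_wb_wd hg i j
  have hc (k i j) := h.commute_wc_wd hg k i j
  have hd (k l i j) := h.commute_wd_wd hg k l i j
  { a₁ := g 0, a₂ := g 1, b := wb g, c₁ := wc g 0, c₂ := wc g 1, d₁ := wd g 0 0, d₂ := wd g 0 1
    d₃ := wd g 1 0, d₄ := wd g 1 1, ε := we g 1 0 0, η := we g 1 1 0, θ := we g 1 1 1
    gen := by
      rw [← hg]; congr 1; ext x
      simp [Fin.exists_fin_two, eq_comm]
    a₁_pow := h.a0
    a₂_pow := h.a1
    b_pow := h.b
    c₁_pow := h.c0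
    c₂_pow := h.c1e
    d₁_pow := h.d _ _
    d₂_pow := h.d _ _
    d₃_pow := h.d _ _
    d₄_pow := h.d _ _
    ε_pow := h.e _ _ _
    η_pow := h.e _ _ _
    θ_pow := h.e _ _ _
    hε := h.commute_we hg _ _ _
    hη := h.commute_we hg _ _ _
    hθ := h.commute_we hg _ _ _
    a₁_a₂ := cj_comm _ _
    b_a₁ := cj_comm _ _
    b_a₂ := cj_comm _ _
    c₁_a₁ := cj_comm _ _
    c₁_a₂ := cj_comm _ _
    c₂_a₁ := cj_comm _ _
    c₂_a₂ := cj_comm _ _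
    d₁_a₁ := by rw [cj_gen_wd, h.e0, mul_one]
    d₁_a₂ := by rw [cj_gen_wd, h2]
    d₂_a₁ := by rw [cj_gen_wd, h5]
    d₂_a₂ := by rw [cj_gen_wd, h.e3, mul_one]
    d₃_a₁ := cj_comm _ _
    d₃_a₂ := by rw [cj_gen_wd, h6, mul_one]
    d₄_a₁ := cj_comm _ _
    d₄_a₂ := cj_comm _ _
    c₁_b := by
      -- The factor is e₂e₃⁻¹ = ε⁻², which equals ε because ε³ = 1.
      rw [h.cj_wb_wc hg, h2, h5, mul_right_inj, ← mul_inv_rev, inv_eq_iff_mul_eq_one]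
      simpa [pow_succ] using h.e 1 0 0
    c₂_b := by rw [h.cj_wb_wc hg, h6, one_mul]
    c₁_c₂ := h.commute_wc_wc hg 1 0
    d₁_b := hb _ _
    d₂_b := hb _ _
    d₃_b := hb _ _
    d₄_b := hb _ _
    d₁_c₁ := hc _ _ _
    d₂_c₁ := hc _ _ _
    d₃_c₁ := hc _ _ _
    d₄_c₁ := hc _ _ _
    d₁_c₂ := hc _ _ _
    d₂_c₂ := hc _ _ _
    d₃_c₂ := hc _ _ _
    d₄_c₂ := hc _ _ _
    d₁_d₂ := hd _ _ _ _
    d₁_d₃ := hd _ _ _ _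
    d₁_d₄ := hd _ _ _ _
    d₂_d₃ := hd _ _ _ _
    d₂_d₄ := hd _ _ _ _
    d₃_d₄ := hd _ _ _ _ }

end SemiAbelian

/-! ### A monomial representation in which ε survives. -/

namespace SemiAbelian

/-- Monomial permutations of `X` with coefficients in `A`: the pair `(σ, f)` acts on `X × A` by
`(x, t) ↦ (σ x, t + f x)`. -/
@[ext]
structure Mono (X A : Type*) where
  perm : Equiv.Perm X
  val : X → A

namespace Mono
variable {X A : Type*} [AddCommGroup A]

instance : One (Mono X A) := ⟨⟨1, 0⟩⟩
instance : Mul (Mono X A) := ⟨fun p q => ⟨p.perm * q.perm, fun x => q.val x + p.val (q.perm x)⟩⟩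
instance : Inv (Mono X A) := ⟨fun p => ⟨p.perm⁻¹, fun x => -p.val (p.perm⁻¹ x)⟩⟩

theorem one_perm : (1 : Mono X A).perm = 1 := rfl
theorem one_val : (1 : Mono X A).val = 0 := rfl
theorem mul_perm (p q : Mono X A) : (p * q).perm = p.perm * q.perm := rfl
theorem mul_val (p q : Mono X A) (x : X) : (p * q).val x = q.val x + p.val (q.perm x) := rfl
theorem inv_perm (p : Mono X A) : p⁻¹.perm = p.perm⁻¹ := rfl
theorem inv_val (p : Mono X A) (x : X) : p⁻¹.val x = -p.val (p.perm⁻¹ x) := rfl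

instance : Group (Mono X A) where
  mul_assoc p q r := by
    ext x
    · rfl
    · simp [mul_val, mul_perm, add_assoc]
  one_mul p := by ext x <;> simp [mul_val, mul_perm, one_perm, one_val]
  mul_one p := by ext x <;> simp [mul_val, mul_perm, one_perm, one_val]
  inv_mul_cancel p := by
    ext x <;> simp [mul_val, mul_perm, one_perm, one_val, inv_perm, inv_val]

/-- The diagonal element with the given coefficients. -/
def diag : Multiplicative (X → A) →* Mono X A where
  toFun f := ⟨1, f.toAdd⟩
  map_one' := rfl
  map_mul' f g := by ext x <;> simp [mul_val, mul_perm, add_comm]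

theorem diag_perm (f : X → A) : (diag (.ofAdd f)).perm = 1 := rfl
theorem diag_val (f : X → A) : (diag (.ofAdd f)).val = f := rfl

theorem diag_pow (f : X → A) (m : ℕ) : diag (.ofAdd f) ^ m = diag (.ofAdd (m • f)) := by
  rw [← map_pow, ofAdd_nsmul]

end Mono

/-- The points `(x, y, z)` of the Heisenberg group over `ℤ/3`. -/
abbrev Pt := ZMod 3 × ZMod 3 × ZMod 3

/-- The embedding of `ℤ/3` into `ℤ/9`. -/
def τ (t : ZMod 3) : ZMod 9 := 3 * (t.val : ZMod 9)

/-- The monomial permutation that represents `a₁`. -/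
def M₁ : Mono Pt (ZMod 9) where
  perm := ⟨fun p => (p.1 + 1, p.2.1, p.2.2 + p.2.1), fun p => (p.1 - 1, p.2.1, p.2.2 - p.2.1),
    fun _ => by simp, fun _ => by simp⟩
  val p := (![![7, 6, 0], ![7, 3, 0], ![1, 0, 0]] : Fin 3 → Fin 3 → ZMod 9) p.1 p.2.1 +
    τ (p.2.2 * (1 + p.1) * (1 + p.2.1))

/-- The monomial permutation that represents `a₂`. -/
def M₂ : Mono Pt (ZMod 9) where
  perm := ⟨fun p => (p.1, p.2.1 + 1, p.2.2), fun p => (p.1, p.2.1 - 1, p.2.2),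
    fun _ => by simp, fun _ => by simp⟩
  val p := if p.2.1 = 2 then 6 - τ p.2.2 else 0

/-- The monomial permutation that represents `b`. -/
def Mb : Mono Pt (ZMod 9) where
  perm := ⟨fun p => (p.1, p.2.1, p.2.2 + 1), fun p => (p.1, p.2.1, p.2.2 - 1),
    fun _ => by simp, fun _ => by simp⟩
  val p := (![![5, 6, 7], ![8, 3, 7], ![8, 0, 1]] : Fin 3 → Fin 3 → ZMod 9) p.1 p.2.1 +
    τ (p.2.2 * (1 + p.1))

/-- The coefficients of the diagonal elements that represent `c₁` and `c₂`. -/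
def Mc : Fin 2 → Pt → ZMod 9 :=
  ![fun p => τ (p.2.2 + p.1 + p.2.1 * (2 + p.1)), fun p => 1 - τ (p.1 + p.1 ^ 2)]

/-- The coefficients of the diagonal elements that represent the `d`. -/
def Md : Fin 2 → Fin 2 → Pt → ZMod 9 :=
  ![![fun p => τ (1 - p.2.1), fun p => τ (2 + p.1)], ![fun p => τ (1 + p.1), 0]]

/-- The coefficients of the diagonal elements that represent the `e`. -/
def Me : Fin 2 → Fin 2 → Fin 2 → Pt → ZMod 9 :=
  ![![![0, fun _ => 6], ![fun _ => 3, 0]], ![![fun _ => 3, 0], ![0, 0]]]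

theorem Mono.ext_of_forall {X A : Type*} {p q : Mono X A}
    (h : ∀ x, p.perm x = q.perm x ∧ p.val x = q.val x) : p = q :=
  Mono.ext (Equiv.ext fun x => (h x).1) (funext fun x => (h x).2)

/-- The permutations of `M₁` and `M₂` generate the Heisenberg group over ℤ/3 acting on its 27
points, with b mapped to a central translation. So all longer commutators are diagonal, and every
relation is a finite check of coefficients. -/
theorem wb_mono : wb ![M₁, M₂] = Mb :=
  comm_eq_of_mul_eq (Mono.ext_of_forall (by decide +kernel))

theorem wc_mono (i) : wc ![M₁, M₂] i = Mono.diag (.ofAdd (Mc i)) := by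
  rw [wc, wb_mono]
  refine comm_eq_of_mul_eq (Mono.ext_of_forall ?_)
  revert i; decide +kernel

theorem wd_mono (i j) : wd ![M₁, M₂] i j = Mono.diag (.ofAdd (Md i j)) := by
  rw [wd, wc_mono]
  refine comm_eq_of_mul_eq (Mono.ext_of_forall ?_)
  revert i j; decide +kernel

theorem we_mono (i j k) : we ![M₁, M₂] i j k = Mono.diag (.ofAdd (Me i j k)) := by
  rw [we, wd_mono]
  refine comm_eq_of_mul_eq (Mono.ext_of_forall ?_)
  revert i j k; decide +kernel

theorem M₁_pow : M₁ ^ 9 = 1 := by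
  have : M₁ ^ 3 = Mono.diag (.ofAdd fun p => τ (2 - p.2.1)) := Mono.ext_of_forall (by decide +kernel)
  rw [pow_mul M₁ 3 3, this, Mono.diag_pow]
  exact Mono.ext_of_forall (by decide +kernel)

theorem M₂_pow : M₂ ^ 9 = 1 := by
  have : M₂ ^ 3 = Mono.diag (.ofAdd fun p => τ (2 - p.2.2)) := Mono.ext_of_forall (by decide +kernel)
  rw [pow_mul M₂ 3 3, this, Mono.diag_pow]
  exact Mono.ext_of_forall (by decide +kernel)

theorem Mb_pow : Mb ^ 9 = 1 := by
  have : Mb ^ 3 = Mono.diag (.ofAdd fun p => τ (2 + p.2.1)) := Mono.ext_of_forall (by decide +kernel)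
  rw [pow_mul Mb 3 3, this, Mono.diag_pow]
  exact Mono.ext_of_forall (by decide +kernel)

theorem rel_mono (n : ℕ) (hn : 2 ≤ n) : Rel n ![M₁, M₂] where
  a0 := M₁_pow
  a1 := by
    obtain ⟨k, rfl⟩ := Nat.exists_eq_add_of_le hn
    rw [pow_add, pow_mul]
    simp [M₂_pow]
  b := by rw [wb_mono]; exact Mb_pow
  c0 := by rw [wc_mono, Mono.diag_pow]; exact Mono.ext_of_forall (by decide +kernel)
  c1 := by rw [wc_mono, Mono.diag_pow]; exact Mono.ext_of_forall (by decide +kernel)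
  d i j := by
    rw [wd_mono, Mono.diag_pow]; refine Mono.ext_of_forall ?_; revert i j; decide +kernel
  e i j k := by
    rw [we_mono, Mono.diag_pow]; refine Mono.ext_of_forall ?_; revert i j k; decide +kernel
  central i j k l := by
    rw [we_mono]
    refine comm_eq_of_mul_eq (Mono.ext_of_forall ?_)
    revert i j k l; decide +kernel
  c1e := by rw [wc_mono, we_mono, Mono.diag_pow]; exact Mono.ext_of_forall (by decide +kernel)
  e12 := by rw [we_mono, we_mono]; exact Mono.ext_of_forall (by decide +kernel)
  e0 := by rw [we_mono]; exact Mono.ext_of_forall (by decide +kernel)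
  e3 := by rw [we_mono]; exact Mono.ext_of_forall (by decide +kernel)

end SemiAbelian

/-! ### Small quotients: abelian, Heisenberg over ℤ/9, and C₃ ≀ C₃. -/

namespace SemiAbelian

section Words
variable {G H : Type*} [Group G] [Group H]

theorem comm_one_left (x : G) : comm 1 x = 1 := by simp [comm]

theorem map_wb (f : G →* H) (g : Fin 2 → G) : f (wb g) = wb (f ∘ g) := by simp [wb, map_comm]

theorem map_wc (f : G →* H) (g : Fin 2 → G) (i) : f (wc g i) = wc (f ∘ g) i := by
  simp [wc, map_comm, map_wb]

theorem map_wd (f : G →* H) (g : Fin 2 → G) (i j) : f (wd g i j) = wd (f ∘ g) i j := by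
  simp [wd, map_comm, map_wc]

theorem map_we (f : G →* H) (g : Fin 2 → G) (i j k) : f (we g i j k) = we (f ∘ g) i j k := by
  simp [we, map_comm, map_wd]

/-- A pair whose words `d` are trivial satisfies the relations as soon as the relations in
weight at most three hold. -/
theorem Rel.of_wd_eq_one {n : ℕ} {g : Fin 2 → G} (h0 : g 0 ^ 9 = 1) (h1 : g 1 ^ 3 ^ n = 1)
    (hb : wb g ^ 9 = 1) (hc0 : wc g 0 ^ 3 = 1) (hc1 : wc g 1 ^ 3 = 1)
    (hd : ∀ i j, wd g i j = 1) : Rel n g := by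
  have he (i j k) : we g i j k = 1 := by rw [we, hd, comm_one_left]
  refine ⟨h0, h1, hb, hc0, ?_, fun i j => ?_, fun i j k => ?_, fun i j k l => ?_, ?_, ?_, ?_, ?_⟩
  · rw [pow_two 3, pow_mul, hc1, one_pow]
  all_goals simp [he, hd, hc1, comm_one_left]

end Words

theorem exists_hom_comm (n : ℕ) {A : Type*} [CommGroup A] (x y : A) (hx : x ^ 9 = 1)
    (hy : y ^ 3 ^ n = 1) :
    ∃ φ : ExampleGroup n →* A, φ (PresentedGroup.of 0) = x ∧ φ (PresentedGroup.of 1) = y := by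
  have hc (u v : A) : comm u v = 1 := comm_eq_one_iff.2 (Commute.all u v)
  have h : Rel n ![x, y] := Rel.of_wd_eq_one hx hy (by simp [wb, hc]) (by simp [wc, hc])
    (by simp [wc, hc]) (by simp [wd, hc])
  obtain ⟨φ, hφ⟩ := h.exists_hom
  exact ⟨φ, hφ 0, hφ 1⟩

namespace Mono
variable {R : Type*} [AddCommGroup R]

/-- The translation by `s`. -/
def shift (R : Type*) [AddCommGroup R] : Multiplicative R →* Mono R R where
  toFun s := ⟨Equiv.addRight s.toAdd, 0⟩
  map_one' := by ext <;> simp [one_perm, one_val]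
  map_mul' s t := by ext <;> simp [mul_perm, mul_val, add_comm, add_left_comm]

theorem shift_perm (s x : R) : (shift R (.ofAdd s)).perm x = x + s := rfl
theorem shift_val (s : R) : (shift R (.ofAdd s)).val = 0 := rfl

theorem shift_pow (s : R) (m : ℕ) : shift R (.ofAdd s) ^ m = shift R (.ofAdd (m • s)) := by
  rw [← map_pow, ofAdd_nsmul]

theorem diag_mul {X A : Type*} [AddCommGroup A] (f g : X → A) :
    diag (.ofAdd f) * diag (.ofAdd g) = diag (.ofAdd (f + g)) := by
  rw [← map_mul, ofAdd_add]

theorem diag_injective {X A : Type*} [AddCommGroup A] {f g : X → A}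
    (h : diag (.ofAdd f) = diag (.ofAdd g)) : f = g := congrArg val h

theorem comm_diag_shift (f : R → R) (s : R) :
    comm (diag (.ofAdd f)) (shift R (.ofAdd s)) = diag (.ofAdd fun t => f (t + s) - f t) := by
  refine comm_eq_of_mul_eq (ext_of_forall fun t => ⟨rfl, ?_⟩)
  simp [mul_val, diag_val, diag_perm, shift_val, shift_perm]

theorem cj_diag {X A : Type*} [AddCommGroup A] (p : Mono X A) (f : X → A) :
    cj p (diag (.ofAdd f)) = diag (.ofAdd (f ∘ p.perm)) := by
  rw [cj_apply, mul_assoc, inv_mul_eq_iff_eq_mul]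
  refine ext_of_forall fun t => ⟨rfl, ?_⟩
  simp [mul_val, diag_val, diag_perm, add_comm]

theorem comm_diag_diag {X A : Type*} [AddCommGroup A] (f g : X → A) :
    comm (diag (.ofAdd f)) (diag (.ofAdd g)) = 1 :=
  comm_eq_one_iff.2 (by rw [Commute, SemiconjBy, diag_mul, diag_mul, add_comm])

theorem diag_zero {X A : Type*} [AddCommGroup A] : diag (.ofAdd (fun _ : X => (0 : A))) = 1 := rfl

end Mono

open Mono

/-- The generators of the Heisenberg group over `ℤ/9`, acting on functions on `ℤ/9`. -/
def heis : Fin 2 → Mono (ZMod 9) (ZMod 9) := ![diag (.ofAdd fun t => t), shift _ (.ofAdd 1)]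

theorem wb_heis : wb heis = diag (.ofAdd fun _ => 1) := by
  rw [wb, heis]; simp [comm_diag_shift]

theorem wc_heis (i) : wc heis i = 1 := by
  rw [wc, wb_heis, heis]
  fin_cases i <;> simp [comm_diag_diag, comm_diag_shift, diag_zero]

theorem rel_heis {n : ℕ} (hn : 2 ≤ n) : Rel n heis := by
  refine Rel.of_wd_eq_one ?_ ?_ ?_ ?_ ?_ fun i j => ?_
  · exact (diag_pow _ _).trans (ext_of_forall (by decide +kernel))
  · obtain ⟨k, rfl⟩ := Nat.exists_eq_add_of_le hn
    have : heis 1 ^ 3 ^ 2 = 1 := (shift_pow _ _).trans (ext_of_forall (by decide +kernel))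
    rw [pow_add, pow_mul, this, one_pow]
  · rw [wb_heis]; exact (diag_pow _ _).trans (ext_of_forall (by decide +kernel))
  · simp [wc_heis]
  · simp [wc_heis]
  · simp [wd, wc_heis, comm_one_left]

/-- The generators of the wreath product of two cyclic groups of order three. -/
def wreath : Fin 2 → Mono (ZMod 3) (ZMod 3) :=
  ![diag (.ofAdd fun t => 2 * t * (t - 1)), shift _ (.ofAdd 1)]

/-- Modulo 3, 2t(t-1) is the binomial coefficient t(t-1)/2, so its successive differences under the
shift are t, 1 and 0: the values of b, c₂ and d₄. -/
theorem wb_wreath : wb wreath = diag (.ofAdd fun t => t) := by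
  have : (fun t : ZMod 3 => 2 * (t + 1) * (t + 1 - 1) - 2 * t * (t - 1)) = fun t => t := by
    funext t; revert t; decide
  rw [wb, wreath]
  exact (comm_diag_shift _ _).trans (by rw [this])

theorem wc_wreath_zero : wc wreath 0 = 1 := by
  rw [wc, wb_wreath]; exact comm_diag_diag _ _

theorem wc_wreath_one : wc wreath 1 = diag (.ofAdd fun _ => 1) := by
  rw [wc, wb_wreath]; exact (comm_diag_shift _ _).trans (by simp)

theorem wd_wreath (i j) : wd wreath i j = 1 := by
  rw [wd]
  fin_cases i
  · exact (congrArg (comm · _) wc_wreath_zero).trans (comm_one_left _)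
  · refine (congrArg (comm · _) wc_wreath_one).trans ?_
    fin_cases j
    · exact comm_diag_diag _ _
    · exact (comm_diag_shift _ _).trans (by simp [diag_zero])

theorem rel_wreath {n : ℕ} (hn : 1 ≤ n) : Rel n wreath := by
  refine Rel.of_wd_eq_one ?_ ?_ ?_ ?_ ?_ wd_wreath
  · exact (diag_pow _ _).trans (ext_of_forall (by decide +kernel))
  · obtain ⟨k, rfl⟩ := Nat.exists_eq_add_of_le hn
    have : wreath 1 ^ 3 ^ 1 = 1 := (shift_pow _ _).trans (ext_of_forall (by decide +kernel))
    rw [pow_add, pow_mul, this, one_pow]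
  · rw [wb_wreath]; exact (diag_pow _ _).trans (ext_of_forall (by decide +kernel))
  · simp [wc_wreath_zero]
  · rw [wc_wreath_one]; exact (diag_pow _ _).trans (ext_of_forall (by decide +kernel))

end SemiAbelian

/-! ### The norm map on the abelian normal subgroup, written additively. -/

namespace SemiAbelian

section Action
variable {G V : Type*} [Group G] [AddCommGroup V]

/-- The action of an element of `G` on the abelian normal subgroup generated by `a₁³`, `b³`, `G₃`,
with exponents `i`, `j` of the element in `a₁`, `a₂`. -/
structure ActsBy (A B C₁ C₂ D₁ D₂ D₃ D₄ E F T : V) (i j : ℤ) (f : V →+ V) : Prop where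
  on_E : f E = E
  on_F : f F = F
  on_T : f T = T
  on_D₁ : f D₁ = D₁ - j • E
  on_D₂ : f D₂ = D₂ + i • E
  on_D₃ : f D₃ = D₃ + i • E
  on_D₄ : f D₄ = D₄ + i • F + j • T
  on_B : f B = B + j • E
  on_C₁ : ∃ p : ℤ, f C₁ = C₁ + i • D₁ + j • D₂ + p • E
  on_C₂ : ∃ p q r : ℤ, f C₂ = C₂ + i • D₃ + j • D₄ + p • E + q • F + r • T
  on_A : ∃ p : ℤ, f A = A + j • (B + D₁) + p • E

variable {A B C₁ C₂ D₁ D₂ D₃ D₄ E F T : V} {i j i' j' : ℤ} {f f' : V →+ V}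

theorem ActsBy.id : ActsBy A B C₁ C₂ D₁ D₂ D₃ D₄ E F T 0 0 (AddMonoidHom.id V) := by
  refine ⟨rfl, rfl, rfl, ?_, ?_, ?_, ?_, ?_, ⟨0, ?_⟩, ⟨0, 0, 0, ?_⟩, ⟨0, ?_⟩⟩ <;> simp

/-- Cross terms are absorbed by the unspecified central coefficients. None arises for A, since B +
D₁ is fixed: the contributions ±j'E cancel. -/
theorem ActsBy.comp (h : ActsBy A B C₁ C₂ D₁ D₂ D₃ D₄ E F T i j f)
    (h' : ActsBy A B C₁ C₂ D₁ D₂ D₃ D₄ E F T i' j' f') :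
    ActsBy A B C₁ C₂ D₁ D₂ D₃ D₄ E F T (i + i') (j + j') (f'.comp f) := by
  obtain ⟨p, hp⟩ := h.on_C₁
  obtain ⟨p', hp'⟩ := h'.on_C₁
  obtain ⟨q, r, s, hq⟩ := h.on_C₂
  obtain ⟨q', r', s', hq'⟩ := h'.on_C₂
  obtain ⟨t, ht⟩ := h.on_A
  obtain ⟨t', ht'⟩ := h'.on_A
  refine ⟨?_, ?_, ?_, ?_, ?_, ?_, ?_, ?_, ⟨p + p' - i * j' + j * i', ?_⟩,
    ⟨q + q' + i * i', r + r' + j * i', s + s' + j * j', ?_⟩, ⟨t + t', ?_⟩⟩ <;>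
  simp only [AddMonoidHom.comp_apply, h.on_E, h.on_F, h.on_T, h.on_D₁, h.on_D₂, h.on_D₃, h.on_D₄, h.on_B, hp, hq, ht,
    map_add, map_sub, map_zsmul, h'.on_E, h'.on_F, h'.on_T, h'.on_D₁, h'.on_D₂, h'.on_D₃, h'.on_D₄, h'.on_B, hp', hq', ht']
  all_goals module

/-- The norm map `1 + f + f²`. -/
def nrm (f : V →+ V) : V →+ V := f.comp f + f + AddMonoidHom.id V

theorem nrm_apply (f : V →+ V) (v : V) : nrm f v = f (f v) + f v + v := rfl

/-- The orders of the generators of the abelian normal subgroup. -/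
structure ActsBy.Exp (A B C₁ C₂ D₁ D₂ D₃ D₄ E F T : V) : Prop where
  on_A : (3 : ℤ) • A = 0
  on_B : (3 : ℤ) • B = 0
  on_C₁ : (3 : ℤ) • C₁ = 0
  on_C₂ : (3 : ℤ) • C₂ = E
  on_D₁ : (3 : ℤ) • D₁ = 0
  on_D₂ : (3 : ℤ) • D₂ = 0
  on_D₃ : (3 : ℤ) • D₃ = 0
  on_D₄ : (3 : ℤ) • D₄ = 0
  on_E : (3 : ℤ) • E = 0
  on_F : (3 : ℤ) • F = 0
  on_T : (3 : ℤ) • T = 0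

/-- With f = 1 + ν the norm is 3 + 3ν + ν². On each listed v both 3v and 3νv vanish, and ν²v = 0;
for C₁ the latter is the cancellation -ijE + jiE coming from e₂e₃ = 1. -/
theorem ActsBy.nrm_eq_zero (h : ActsBy A B C₁ C₂ D₁ D₂ D₃ D₄ E F T i j f)
    (e : ActsBy.Exp A B C₁ C₂ D₁ D₂ D₃ D₄ E F T) :
    ∀ v ∈ ({A, B, C₁, D₁, D₂, D₃, D₄, E, F, T} : Set V), nrm f v = 0 := by
  obtain ⟨p, hp⟩ := h.on_C₁
  obtain ⟨t, ht⟩ := h.on_A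
  simp only [Set.mem_insert_iff, Set.mem_singleton_iff, forall_eq_or_imp, forall_eq, nrm_apply,
    h.on_E, h.on_F, h.on_T, h.on_D₁, h.on_D₂, h.on_D₃, h.on_D₄, h.on_B, hp, ht, map_add, map_sub, map_zsmul]
  refine ⟨?_, ?_, ?_, ?_, ?_, ?_, ?_, ?_, ?_, ?_⟩
  · calc _ = (3 : ℤ) • A + j • (3 : ℤ) • B + j • (3 : ℤ) • D₁ + t • (3 : ℤ) • E := by module
      _ = 0 := by simp [e.on_A, e.on_B, e.on_D₁, e.on_E]
  · calc _ = (3 : ℤ) • B + j • (3 : ℤ) • E := by module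
      _ = 0 := by simp [e.on_B, e.on_E]
  · calc _ = (3 : ℤ) • C₁ + i • (3 : ℤ) • D₁ + j • (3 : ℤ) • D₂ + p • (3 : ℤ) • E := by module
      _ = 0 := by simp [e.on_C₁, e.on_D₁, e.on_D₂, e.on_E]
  · calc _ = (3 : ℤ) • D₁ - j • (3 : ℤ) • E := by module
      _ = 0 := by simp [e.on_D₁, e.on_E]
  · calc _ = (3 : ℤ) • D₂ + i • (3 : ℤ) • E := by module
      _ = 0 := by simp [e.on_D₂, e.on_E]
  · calc _ = (3 : ℤ) • D₃ + i • (3 : ℤ) • E := by module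
      _ = 0 := by simp [e.on_D₃, e.on_E]
  · calc _ = (3 : ℤ) • D₄ + i • (3 : ℤ) • F + j • (3 : ℤ) • T := by module
      _ = 0 := by simp [e.on_D₄, e.on_F, e.on_T]
  · calc _ = (3 : ℤ) • E := by module
      _ = 0 := e.on_E
  · calc _ = (3 : ℤ) • F := by module
      _ = 0 := e.on_F
  · calc _ = (3 : ℤ) • T := by module
      _ = 0 := e.on_T

/-- In 3 + 3ν + ν² two terms survive: 3C₂ = E, and ν²C₂ = i²E + ijF + j²T. -/
theorem ActsBy.nrm_C₂ (h : ActsBy A B C₁ C₂ D₁ D₂ D₃ D₄ E F T i j f)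
    (e : ActsBy.Exp A B C₁ C₂ D₁ D₂ D₃ D₄ E F T) :
    nrm f C₂ = (1 + i ^ 2) • E + (i * j) • F + j ^ 2 • T := by
  obtain ⟨p, q, r, hp⟩ := h.on_C₂
  simp only [nrm_apply, h.on_E, h.on_F, h.on_T, h.on_D₃, h.on_D₄, hp, map_add, map_zsmul]
  calc _ = (3 : ℤ) • C₂ + i • (3 : ℤ) • D₃ + j • (3 : ℤ) • D₄ + p • (3 : ℤ) • E +
        q • (3 : ℤ) • F + r • (3 : ℤ) • T + (i ^ 2 • E + (i * j) • F + j ^ 2 • T) := by module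
    _ = _ := by rw [e.on_C₂, e.on_D₃, e.on_D₄, e.on_E, e.on_F, e.on_T]; module

end Action
end SemiAbelian

/-! ### Cubes of a₁ and b and their conjugates. -/

namespace SemiAbelian

section Group
variable {G : Type*} [Group G]

theorem mul_eq_of_cj {g x z : G} (h : cj g x = x * z) : x * g = g * (x * z) := by
  rw [← h, cj_apply]; group

theorem mul_mul_eq_of_eq {x y z : G} (h : x * y = z) (w : G) : x * (y * w) = z * w := by
  rw [← mul_assoc, h]

/-- If `[y, x]` is central of order dividing `3` then `(xy)³ = x³y³`. -/
theorem mul_pow_three {x y z : G} (h : y * x = x * (y * z)) (hz : ∀ w, Commute w z)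
    (hz3 : z ^ 3 = 1) : (x * y) ^ 3 = x ^ 3 * y ^ 3 := by
  have h' := mul_mul_eq_of_eq h
  have zx (w) : z * (x * w) = x * (z * w) := (hz x).symm.left_comm w
  have zy (w) : z * (y * w) = y * (z * w) := (hz y).symm.left_comm w
  have zy' : z * y = y * z := (hz y).symm.eq
  have z3 : z * (z * z) = 1 := by simpa [pow_succ, mul_assoc] using hz3
  simp only [pow_succ, pow_zero, one_mul, mul_assoc, h', zx, zy, zy', z3, mul_one]

theorem commute_pow_three_of_cj {g x z : G} (h : cj g x = x * z) (hz : cj g z = z)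
    (hz3 : z ^ 3 = 1) : Commute (g ^ 3) x := by
  rw [← cj_eq_iff, pow_succ, pow_succ, pow_one, cj_mul_left, cj_mul_left]
  simp only [h, hz, map_mul]
  simp only [mul_assoc] at *
  rw [show z * (z * z) = z ^ 3 by simp [pow_succ, mul_assoc], hz3, mul_one]

/-- Three conjugations turn x into xz³w³. -/
theorem commute_pow_three_of_cj_cj {g x z w : G} (h : cj g x = x * z) (hz : cj g z = z * w)
    (hw : ∀ y, Commute y w) (hz3 : z ^ 3 = 1) (hw3 : w ^ 3 = 1) : Commute (g ^ 3) x := by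
  have e : w * (w * w) = 1 := by simpa [pow_succ, mul_assoc] using hw3
  rw [← cj_eq_iff, pow_succ, pow_succ, pow_one, cj_mul_left, cj_mul_left]
  simp only [h, hz, cj_of_commute (hw g), map_mul, mul_assoc, (hw z).symm.left_comm, e, mul_one]
  rw [show z * (z * z) = z ^ 3 by simp [pow_succ, mul_assoc], hz3, mul_one]

end Group

namespace Sys
variable {n : ℕ} {G : Type*} [Group G] (S : Sys n G)

/-- The generators have finite order, so they generate G as a monoid and no step for inverses is
needed. -/
theorem induction {p : G → Prop} (one : p 1) (h₁ : p S.a₁) (h₂ : p S.a₂)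
    (mul : ∀ x y, p x → p y → p (x * y)) (x : G) : p x := by
  have hx : x ∈ (Subgroup.closure {S.a₁, S.a₂}).toSubmonoid := by rw [S.gen]; trivial
  rw [Subgroup.closure_toSubmonoid_of_isOfFinOrder] at hx
  · induction hx using Submonoid.closure_induction with
    | mem x hx => rcases hx with rfl | rfl <;> assumption
    | one => exact one
    | mul x y _ _ hx hy => exact mul x y hx hy
  · rintro x (rfl | rfl)
    · exact isOfFinOrder_iff_pow_eq_one.2 ⟨9, by norm_num, S.a₁_pow⟩
    · exact isOfFinOrder_iff_pow_eq_one.2 ⟨3 ^ n, by positivity, S.a₂_pow⟩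

theorem induction_right {p : G → Prop} (one : p 1) (h₁ : ∀ x, p x → p (x * S.a₁))
    (h₂ : ∀ x, p x → p (x * S.a₂)) (x : G) : p x := by
  have : ∀ y, p y → p (y * x) :=
    S.induction (p := fun x => ∀ y, p y → p (y * x)) (by simp) (fun y => h₁ y) (fun y => h₂ y)
      (fun x z hx hz y hy => by rw [← mul_assoc]; exact hz _ (hx _ hy)) x
  simpa using this 1 one

theorem cj_ε (y : G) : cj y S.ε = S.ε := cj_of_commute (S.hε y)
theorem cj_η (y : G) : cj y S.η = S.η := cj_of_commute (S.hη y)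
theorem cj_θ (y : G) : cj y S.θ = S.θ := cj_of_commute (S.hθ y)

theorem ε_inv_pow : S.ε⁻¹ ^ 3 = 1 := by rw [inv_pow, S.ε_pow, inv_one]
theorem η_inv_pow : S.η⁻¹ ^ 3 = 1 := by rw [inv_pow, S.η_pow, inv_one]

theorem a₁_b3 : Commute S.a₁ (S.b ^ 3) := by
  rw [← cj_eq_iff, map_pow, S.b_a₁, mul_pow_three (mul_eq_of_cj S.c₁_b) S.hε S.ε_pow, S.c₁_pow,
    mul_one]

theorem b3_a₂ : cj S.a₂ (S.b ^ 3) = S.b ^ 3 * S.ε := by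
  rw [map_pow, S.b_a₂, mul_pow_three (mul_eq_of_cj S.c₂_b) (fun w => (S.hη w).inv_right)
    S.η_inv_pow, S.c₂_pow]

theorem c₁_b3 : Commute (S.b ^ 3) S.c₁ := commute_pow_three_of_cj S.c₁_b (S.cj_ε _) S.ε_pow

theorem c₂_b3 : Commute (S.b ^ 3) S.c₂ :=
  commute_pow_three_of_cj S.c₂_b (by rw [map_inv, S.cj_η]) S.η_inv_pow

theorem c₁_a3 : Commute (S.a₁ ^ 3) S.c₁ := commute_pow_three_of_cj S.c₁_a₁ S.d₁_a₁ S.d₁_pow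

theorem d₁_a3 : Commute (S.a₁ ^ 3) S.d₁ := (cj_eq_iff.1 S.d₁_a₁).pow_left 3

theorem d₂_a3 : Commute (S.a₁ ^ 3) S.d₂ := commute_pow_three_of_cj S.d₂_a₁ (S.cj_ε _) S.ε_pow

theorem d₃_a3 : Commute (S.a₁ ^ 3) S.d₃ := commute_pow_three_of_cj S.d₃_a₁ (S.cj_ε _) S.ε_pow

theorem d₄_a3 : Commute (S.a₁ ^ 3) S.d₄ := commute_pow_three_of_cj S.d₄_a₁ (S.cj_η _) S.η_pow

theorem ε3 : S.ε * (S.ε * S.ε) = 1 := by simpa [pow_succ, mul_assoc] using S.ε_pow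

theorem c₂_a3 : Commute (S.a₁ ^ 3) S.c₂ :=
  commute_pow_three_of_cj_cj S.c₂_a₁ S.d₃_a₁ S.hε S.d₃_pow S.ε_pow

theorem b_a3 : Commute (S.a₁ ^ 3) S.b := by
  have hc := mul_mul_eq_of_eq S.d₁_c₁.symm.eq
  have e₁ : S.c₁ * (S.c₁ * S.c₁) = 1 := by simpa [pow_succ, mul_assoc] using S.c₁_pow
  have e₁' := mul_mul_eq_of_eq e₁
  have e₂ : S.d₁ * (S.d₁ * S.d₁) = 1 := by simpa [pow_succ, mul_assoc] using S.d₁_pow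
  rw [← cj_eq_iff, pow_succ, pow_succ, pow_one, cj_mul_left, cj_mul_left]
  simp only [S.b_a₁, S.c₁_a₁, S.d₁_a₁, map_mul, mul_assoc] at *
  simp only [hc, e₁, e₂, mul_one]

/-- Collect (a₁b)³ in the order a₁, b, c₁, d₁, ε; c₁ arises three times and drops out. -/
theorem a3_a₂ : cj S.a₂ (S.a₁ ^ 3) = S.a₁ ^ 3 * (S.b ^ 3 * S.d₁) * S.ε ^ 2 := by
  have r₁ := mul_eq_of_cj S.b_a₁
  have r₂ := mul_eq_of_cj S.c₁_b
  have r₃ := mul_eq_of_cj S.c₁_a₁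
  have r₅ : S.d₁ * S.b = S.b * S.d₁ := S.d₁_b.symm.eq
  have r₆ : S.d₁ * S.c₁ = S.c₁ * S.d₁ := S.d₁_c₁.symm.eq
  have s (y : G) : S.ε * y = y * S.ε := (S.hε y).symm.eq
  have s₂ := s S.b
  have s₃ := s S.c₁
  have s₄ := s S.d₁
  have e₁ : S.c₁ * (S.c₁ * S.c₁) = 1 := by simpa [pow_succ, mul_assoc] using S.c₁_pow
  have e₂ := S.ε3
  have r₁' := mul_mul_eq_of_eq r₁
  have r₂' := mul_mul_eq_of_eq r₂
  have r₃' := mul_mul_eq_of_eq r₃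
  have r₅' := mul_mul_eq_of_eq r₅
  have r₆' := mul_mul_eq_of_eq r₆
  have s₂' := mul_mul_eq_of_eq s₂
  have s₃' := mul_mul_eq_of_eq s₃
  have s₄' := mul_mul_eq_of_eq s₄
  have e₁' := mul_mul_eq_of_eq e₁
  rw [map_pow, S.a₁_a₂]
  simp only [pow_succ, pow_zero, one_mul, mul_assoc] at *
  simp only [r₂, s₄, r₁', r₂', r₃', r₅', r₆', s₂', s₃',
    s₄', e₂, e₁', mul_one]

end Sys
end SemiAbelian

/-! ### The normal subgroups `K₀` and `K`. -/

namespace SemiAbelian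
namespace Sys
variable {n : ℕ} {G : Type*} [Group G] (S : Sys n G)

theorem a₂3_c₁ : Commute (S.a₂ ^ 3) S.c₁ := commute_pow_three_of_cj S.c₁_a₂ S.d₂_a₂ S.d₂_pow

theorem a₂3_c₂ : Commute (S.a₂ ^ 3) S.c₂ :=
  commute_pow_three_of_cj_cj S.c₂_a₂ S.d₄_a₂ S.hθ S.d₄_pow S.θ_pow

theorem a₂3_d₁ : Commute (S.a₂ ^ 3) S.d₁ :=
  commute_pow_three_of_cj S.d₁_a₂ (by rw [map_inv, S.cj_ε]) S.ε_inv_pow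

theorem a₂3_d₂ : Commute (S.a₂ ^ 3) S.d₂ := (cj_eq_iff.1 S.d₂_a₂).pow_left 3

theorem a₂3_d₃ : Commute (S.a₂ ^ 3) S.d₃ := (cj_eq_iff.1 S.d₃_a₂).pow_left 3

theorem a₂3_d₄ : Commute (S.a₂ ^ 3) S.d₄ :=
  commute_pow_three_of_cj S.d₄_a₂ (S.cj_θ _) S.θ_pow

theorem a₂3_b3 : Commute (S.a₂ ^ 3) (S.b ^ 3) :=
  commute_pow_three_of_cj S.b3_a₂ (S.cj_ε _) S.ε_pow

theorem b3_pow : (S.b ^ 3) ^ 3 = 1 := by rw [← pow_mul]; exact S.b_pow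

theorem a3_pow : (S.a₁ ^ 3) ^ 3 = 1 := by rw [← pow_mul]; exact S.a₁_pow

theorem a₂3_a3 : Commute (S.a₂ ^ 3) (S.a₁ ^ 3) := by
  have h := S.a3_a₂
  rw [mul_assoc] at h
  refine commute_pow_three_of_cj h ?_ ?_
  · rw [map_mul, map_mul, S.b3_a₂, map_pow, S.d₁_a₂, S.cj_ε]
    simp only [mul_assoc]
    rw [(S.hε S.d₁).symm.left_comm, mul_inv_cancel_left]
  · rw [((S.hε _).pow_right 2).mul_pow, (S.d₁_b.pow_left 3).mul_pow, S.b3_pow, S.d₁_pow,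
      ← pow_mul, mul_comm 2, pow_mul, S.ε_pow]
    simp

theorem a₁_a₂3 : cj (S.a₂ ^ 3) S.a₁ = S.a₁ * (S.b ^ 3 * (S.ε * (S.η⁻¹ * S.d₄))) := by
  have hη (w) : Commute w S.η⁻¹ := (S.hη w).inv_right
  have r := mul_mul_eq_of_eq (mul_eq_of_cj S.c₂_b)
  rw [pow_succ, pow_succ, pow_one, cj_mul_left, cj_mul_left, ← S.c₂_pow]
  simp only [S.a₁_a₂, S.b_a₂, S.c₂_a₂, map_mul, pow_succ, pow_zero, one_mul, mul_assoc, r,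
    (hη S.c₂).symm.left_comm]

/-- The commutator [a₁, a₂³] commutes with a₂³ and its cube is trivial, so the cube of a₂³
centralizes a₁. -/
theorem commute_a₂_pow (y : G) : Commute (S.a₂ ^ 9) y := by
  have h : Commute (S.a₂ ^ 9) S.a₁ := by
    have hd : Commute (S.b ^ 3) (S.ε * (S.η⁻¹ * S.d₄)) :=
      (S.hε _).mul_right ((S.hη _).inv_right.mul_right (S.d₄_b.pow_left 3))
    rw [show 9 = 3 * 3 from rfl, pow_mul]
    refine commute_pow_three_of_cj S.a₁_a₂3 (cj_of_commute ?_) ?_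
    · exact S.a₂3_b3.mul_right ((S.hε _).mul_right ((S.hη _).inv_right.mul_right S.a₂3_d₄))
    · rw [hd.mul_pow, (S.hε _).symm.mul_pow, (S.hη _).inv_right.symm.mul_pow, S.b3_pow, S.ε_pow,
        S.η_inv_pow, S.d₄_pow]
      simp
  exact S.induction (Commute.one_right _) h ((Commute.refl _).pow_left 9)
    (fun _ _ => Commute.mul_right) y

/-- Generators of the elementary abelian normal subgroup `K₀`. -/
def gen₀ : Set G := {S.a₁ ^ 3, S.b ^ 3, S.c₁, S.d₁, S.d₂, S.d₃, S.d₄, S.ε, S.η, S.θ}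

/-- An elementary abelian normal subgroup, which with `c₂` generates `K`. -/
def K₀ : Subgroup G := Subgroup.closure S.gen₀

/-- An abelian normal subgroup, generated by `a₁³`, `b³` and `G₃`. -/
def K : Subgroup G := Subgroup.closure (insert S.c₂ S.gen₀)

theorem gen₀_subset : S.gen₀ ⊆ S.K₀ := Subgroup.subset_closure

theorem K₀_le : S.K₀ ≤ S.K := Subgroup.closure_mono (Set.subset_insert _ _)

theorem c₂_mem : S.c₂ ∈ S.K := Subgroup.subset_closure (Set.mem_insert _ _)

theorem forall_gen₀ {p : G → Prop} : (∀ x ∈ S.gen₀, p x) ↔ p (S.a₁ ^ 3) ∧ p (S.b ^ 3) ∧ p S.c₁ ∧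
    p S.d₁ ∧ p S.d₂ ∧ p S.d₃ ∧ p S.d₄ ∧ p S.ε ∧ p S.η ∧ p S.θ := by
  simp [gen₀]

theorem commute_gens : ∀ x ∈ insert S.c₂ S.gen₀, ∀ y ∈ insert S.c₂ S.gen₀, x * y = y * x := by
  have h₁ := S.c₁_b3
  have h₂ := S.c₂_b3
  have h₃ := S.c₁_a3
  have h₄ := S.c₂_a3
  have h₅ := S.d₁_a3
  have h₆ := S.d₂_a3
  have h₇ := S.d₃_a3
  have h₈ := S.d₄_a3
  have h₉ : Commute (S.a₁ ^ 3) (S.b ^ 3) := S.b_a3.pow_right 3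
  have k₁ := S.d₁_b.pow_left 3
  have k₂ := S.d₂_b.pow_left 3
  have k₃ := S.d₃_b.pow_left 3
  have k₄ := S.d₄_b.pow_left 3
  obtain ⟨l₁, l₂, l₃⟩ := And.intro S.d₁_c₁ (And.intro S.d₂_c₁ S.d₃_c₁)
  obtain ⟨l₄, l₅, l₆⟩ := And.intro S.d₄_c₁ (And.intro S.d₁_c₂ S.d₂_c₂)
  obtain ⟨l₇, l₈, l₉⟩ := And.intro S.d₃_c₂ (And.intro S.d₄_c₂ S.c₁_c₂)
  obtain ⟨m₁, m₂, m₃⟩ := And.intro S.d₁_d₂ (And.intro S.d₁_d₃ S.d₁_d₄)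
  obtain ⟨m₄, m₅, m₆⟩ := And.intro S.d₂_d₃ (And.intro S.d₂_d₄ S.d₃_d₄)
  rintro x (rfl | rfl | rfl | rfl | rfl | rfl | rfl | rfl | rfl | rfl | rfl) y
    (rfl | rfl | rfl | rfl | rfl | rfl | rfl | rfl | rfl | rfl | rfl) <;>
  first
  | exact S.hε _ | exact (S.hε _).symm | exact S.hη _ | exact (S.hη _).symm | exact S.hθ _
  | exact (S.hθ _).symm | rfl | (refine Commute.eq ?_; assumption)
  | (refine (Commute.symm ?_).eq; assumption)

instance : IsMulCommutative S.K := Subgroup.isMulCommutative_closure S.commute_gens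

theorem commute_K {x y : G} (hx : x ∈ S.K) (hy : y ∈ S.K) : Commute x y :=
  setLike_mul_comm hx hy

theorem mem_gen₀ : S.a₁ ^ 3 ∈ S.K₀ ∧ S.b ^ 3 ∈ S.K₀ ∧ S.c₁ ∈ S.K₀ ∧ S.d₁ ∈ S.K₀ ∧ S.d₂ ∈ S.K₀ ∧
    S.d₃ ∈ S.K₀ ∧ S.d₄ ∈ S.K₀ ∧ S.ε ∈ S.K₀ ∧ S.η ∈ S.K₀ ∧ S.θ ∈ S.K₀ :=
  S.forall_gen₀.1 S.gen₀_subset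

theorem K₀_le_comap (y : G) : S.K₀ ≤ S.K₀.comap (cj y) := by
  obtain ⟨h₁, h₂, h₃, h₄, h₅, h₆, h₇, h₈, h₉, h₀⟩ := S.mem_gen₀
  have key (y : G) (h : ∀ x ∈ S.gen₀, cj y x ∈ S.K₀) : S.K₀ ≤ S.K₀.comap (cj y) :=
    (Subgroup.closure_le _).2 h
  refine S.induction (p := fun y => S.K₀ ≤ S.K₀.comap (cj y)) ?_ (key _ (S.forall_gen₀.2 ?_))
    (key _ (S.forall_gen₀.2 ?_)) ?_ y
  · intro x hx; rwa [Subgroup.mem_comap, cj_one_left]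
  · rw [map_pow, cj_self, cj_of_commute S.a₁_b3, S.c₁_a₁, S.d₁_a₁, S.d₂_a₁, S.d₃_a₁, S.d₄_a₁,
      S.cj_ε, S.cj_η, S.cj_θ]
    exact ⟨h₁, h₂, mul_mem h₃ h₄, h₄, mul_mem h₅ h₈, mul_mem h₆ h₈, mul_mem h₇ h₉, h₈, h₉, h₀⟩
  · rw [S.a3_a₂, S.b3_a₂, S.c₁_a₂, S.d₁_a₂, S.d₂_a₂, S.d₃_a₂, S.d₄_a₂, S.cj_ε, S.cj_η, S.cj_θ]
    exact ⟨mul_mem (mul_mem h₁ (mul_mem h₂ h₄)) (pow_mem h₈ 2), mul_mem h₂ h₈, mul_mem h₃ h₅,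
      mul_mem h₄ (inv_mem h₈), h₅, h₆, mul_mem h₇ h₀, h₈, h₉, h₀⟩
  · intro u v hu hv x hx
    rw [Subgroup.mem_comap, cj_mul_left]
    exact hv (hu hx)

theorem K_le_comap (y : G) : S.K ≤ S.K.comap (cj y) := by
  have h₁ := S.K₀_le S.mem_gen₀.2.2.2.2.2.1
  have h₂ := S.K₀_le S.mem_gen₀.2.2.2.2.2.2.1
  have h₃ := S.c₂_mem
  have key (y : G) (h : cj y S.c₂ ∈ S.K) : S.K ≤ S.K.comap (cj y) := by
    refine (Subgroup.closure_le _).2 ?_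
    rintro x (rfl | hx)
    · exact h
    · exact S.K₀_le (S.K₀_le_comap y (S.gen₀_subset hx))
  refine S.induction (p := fun y => S.K ≤ S.K.comap (cj y)) ?_ (key _ ?_) (key _ ?_) ?_ y
  · intro x hx; rwa [Subgroup.mem_comap, cj_one_left]
  · rw [S.c₂_a₁]; exact mul_mem h₃ h₁
  · rw [S.c₂_a₂]; exact mul_mem h₃ h₂
  · intro u v hu hv x hx
    rw [Subgroup.mem_comap, cj_mul_left]
    exact hv (hu hx)

instance : S.K₀.Normal where
  conj_mem x hx y := by simpa [cj_apply] using S.K₀_le_comap y⁻¹ hx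

theorem commute_a₂3_K {x : G} (hx : x ∈ S.K) : Commute (S.a₂ ^ 3) x := by
  have : S.K ≤ Subgroup.centralizer {S.a₂ ^ 3} := by
    refine (Subgroup.closure_le _).2 ?_
    have h : ∀ x ∈ S.gen₀, Commute (S.a₂ ^ 3) x := S.forall_gen₀.2 ⟨S.a₂3_a3, S.a₂3_b3, S.a₂3_c₁,
      S.a₂3_d₁, S.a₂3_d₂, S.a₂3_d₃, S.a₂3_d₄, S.hε _, S.hη _, S.hθ _⟩
    rintro x (rfl | hx)
    · exact Subgroup.mem_centralizer_singleton_iff.2 S.a₂3_c₂.eq.symm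
    · exact Subgroup.mem_centralizer_singleton_iff.2 (h x hx).eq.symm
  exact (Subgroup.mem_centralizer_singleton_iff.1 (this hx)).symm

theorem pow_of_mem_K₀ {x : G} (hx : x ∈ S.K₀) : x ^ 3 = 1 := by
  have h : ∀ x ∈ S.gen₀, x ^ 3 = 1 := S.forall_gen₀.2 ⟨S.a3_pow, S.b3_pow, S.c₁_pow, S.d₁_pow,
    S.d₂_pow, S.d₃_pow, S.d₄_pow, S.ε_pow, S.η_pow, S.θ_pow⟩
  induction hx using Subgroup.closure_induction with
  | mem x hx => exact h x hx
  | one => simp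
  | mul x y hx hy ihx ihy =>
    rw [(S.commute_K (S.K₀_le hx) (S.K₀_le hy)).mul_pow, ihx, ihy, one_mul]
  | inv x _ ih => rw [inv_pow, ih, inv_one]

end Sys
end SemiAbelian

/-! ### Norms in the group and the normal form modulo `K₀`. -/

namespace SemiAbelian

/-- The norm `z^{y²} z^y z`, so that `(yz)³ = y³ (z^{y²} z^y z)`. -/
def norm₃ {G : Type*} [Group G] (y z : G) : G := cj (y ^ 2) z * cj y z * z

section Norm
variable {G H : Type*} [Group G] [Group H]

theorem mul_pow_three_eq (y z : G) : (y * z) ^ 3 = y ^ 3 * norm₃ y z := by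
  simp [norm₃, cj_apply, pow_succ, mul_assoc]

theorem norm₃_one_left (z : G) : norm₃ 1 z = z ^ 3 := by
  simp [norm₃, cj_apply, pow_succ]

theorem map_norm₃ (f : G →* H) (y z : G) : f (norm₃ y z) = norm₃ (f y) (f z) := by
  simp [norm₃, map_cj]

theorem norm₃_mul_of_central {z : G} (hz : ∀ y, Commute y z) (y x : G) :
    norm₃ y (z * x) = z ^ 3 * norm₃ y x := by
  simp only [norm₃, map_mul, cj_of_commute (hz _), pow_succ, pow_zero, one_mul, mul_assoc,
    (hz (cj y x)).left_comm, (hz (cj (y * y) x)).left_comm]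

/-- Substitute y = a⁻¹ and z = ab: then `norm₃ y z` = a³b³ and z³ = (ab)³. -/
theorem isSemiAbelian_three_iff :
    IsSemiAbelian 3 G ↔ ∀ y z : G, norm₃ y z = 1 ↔ z ^ 3 = 1 := by
  have key (a b : G) : norm₃ a⁻¹ (a * b) = a ^ 3 * b ^ 3 := by
    rw [← inv_mul_eq_iff_eq_mul.2 (mul_pow_three_eq a⁻¹ (a * b)), inv_mul_cancel_left, inv_pow,
      inv_inv]
  constructor
  · intro h y z
    have := h y⁻¹ (y * z)
    rw [← key, inv_inv, inv_mul_cancel_left] at this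
    exact this.symm
  · intro h a b
    rw [← key]
    exact (h _ _).symm

end Norm

namespace Sys
variable {n : ℕ} {G : Type*} [Group G] (S : Sys n G)

theorem norm₃_mul (y : G) {x z : G} (hx : x ∈ S.K) (hz : z ∈ S.K) :
    norm₃ y (x * z) = norm₃ y x * norm₃ y z := by
  have h (u v : G) := (S.commute_K (S.K_le_comap u hx) (S.K_le_comap v hz)).symm
  have h₁ := h y (y ^ 2)
  have h₂ := h 1 (y ^ 2)
  have h₃ := h 1 y
  rw [cj_one_left] at h₂ h₃
  simp only [norm₃, map_mul, mul_assoc]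
  rw [h₃.left_comm, h₁.left_comm, h₂.left_comm]

open scoped IsMulCommutative

/-- The conjugation by `y` on `K`, written additively. -/
def σ (y : G) : Additive S.K →+ Additive S.K :=
  MonoidHom.toAdditive (((cj y).comp S.K.subtype).codRestrict S.K fun x => S.K_le_comap y x.2)

/-- An element of `K`, written additively. -/
def κ (x : G) (hx : x ∈ S.K) : Additive S.K := .ofMul ⟨x, hx⟩

theorem ext_K {u v : Additive S.K} (h : (u.toMul : G) = v.toMul) : u = v :=
  Additive.toMul.injective (Subtype.ext h)

theorem σ_toMul (y : G) (v : Additive S.K) : ((S.σ y v).toMul : G) = cj y v.toMul := rfl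

theorem κ_toMul (x : G) (hx : x ∈ S.K) : ((S.κ x hx).toMul : G) = x := rfl

theorem σ_one : S.σ 1 = AddMonoidHom.id _ :=
  AddMonoidHom.ext fun v => S.ext_K (by rw [σ_toMul, cj_one_left]; rfl)

theorem σ_mul (x y : G) : S.σ (x * y) = (S.σ y).comp (S.σ x) :=
  AddMonoidHom.ext fun v => S.ext_K (by simp only [AddMonoidHom.comp_apply, σ_toMul, cj_mul_left])

theorem nrm_toMul (y : G) (v : Additive S.K) :
    ((nrm (S.σ y) v).toMul : G) = norm₃ y v.toMul := by
  rw [nrm_apply, norm₃, pow_two, cj_mul_left]; rfl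

theorem mem_gens : S.a₁ ^ 3 ∈ S.K ∧ S.b ^ 3 ∈ S.K ∧ S.c₁ ∈ S.K ∧ S.c₂ ∈ S.K ∧ S.d₁ ∈ S.K ∧
    S.d₂ ∈ S.K ∧ S.d₃ ∈ S.K ∧ S.d₄ ∈ S.K ∧ S.ε ∈ S.K ∧ S.η ∈ S.K ∧ S.θ ∈ S.K := by
  obtain ⟨h₁, h₂, h₃, h₄, h₅, h₆, h₇, h₈, h₉, h₀⟩ := S.mem_gen₀
  have := S.K₀_le
  exact ⟨this h₁, this h₂, this h₃, S.c₂_mem, this h₄, this h₅, this h₆, this h₇, this h₈,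
    this h₉, this h₀⟩

/-- The description `ActsBy` holds for both generators and is stable under products, so every y acts
in this way and the additive computation of the norm applies. -/
theorem norm₃_K (y : G) : (∀ z ∈ S.K₀, norm₃ y z = 1) ∧
    ∃ i u v : ℤ, norm₃ y S.c₂ = S.ε ^ (1 + i ^ 2) * S.η ^ u * S.θ ^ v := by
  obtain ⟨hA, hB, hC₁, hC₂, hD₁, hD₂, hD₃, hD₄, hE, hF, hT⟩ := S.mem_gens
  let P (y : G) : Prop := ∃ i j : ℤ, ActsBy (S.κ _ hA) (S.κ _ hB) (S.κ _ hC₁) (S.κ _ hC₂)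
    (S.κ _ hD₁) (S.κ _ hD₂) (S.κ _ hD₃) (S.κ _ hD₄) (S.κ _ hE) (S.κ _ hF) (S.κ _ hT) i j (S.σ y)
  have acts : P y := by
    refine S.induction (p := P) ⟨0, 0, by rw [σ_one]; exact ActsBy.id⟩ ⟨1, 0, ?_⟩ ⟨0, 1, ?_⟩ ?_ y
    · constructor
      case on_C₁ => exact ⟨0, S.ext_K (by simp [σ_toMul, κ_toMul, S.c₁_a₁])⟩
      case on_C₂ => exact ⟨0, 0, 0, S.ext_K (by simp [σ_toMul, κ_toMul, S.c₂_a₁])⟩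
      case on_A => exact ⟨0, S.ext_K (by simp [σ_toMul, κ_toMul, cj_self])⟩
      all_goals
        refine S.ext_K ?_
        simp [σ_toMul, κ_toMul, S.cj_ε, S.cj_η, S.cj_θ, S.d₁_a₁, S.d₂_a₁, S.d₃_a₁, S.d₄_a₁]
      rw [← map_pow, cj_of_commute S.a₁_b3]
    · constructor
      case on_C₁ => exact ⟨0, S.ext_K (by simp [σ_toMul, κ_toMul, S.c₁_a₂])⟩
      case on_C₂ => exact ⟨0, 0, 0, S.ext_K (by simp [σ_toMul, κ_toMul, S.c₂_a₂])⟩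
      -- The 2 is the exponent of ε in `a3_a₂`.
      case on_A => exact ⟨2, S.ext_K (by rw [σ_toMul, κ_toMul, S.a3_a₂]; simp [κ_toMul])⟩
      case on_B => exact S.ext_K (by rw [σ_toMul, κ_toMul, S.b3_a₂]; simp [κ_toMul])
      all_goals
        refine S.ext_K ?_
        simp [σ_toMul, κ_toMul, S.cj_ε, S.cj_η, S.cj_θ, S.d₁_a₂, S.d₂_a₂, S.d₃_a₂, S.d₄_a₂,
          div_eq_mul_inv]
    · rintro u v ⟨i, j, h⟩ ⟨i', j', h'⟩
      exact ⟨_, _, by rw [σ_mul]; exact h.comp h'⟩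
  obtain ⟨i, j, h⟩ := acts
  have e : ActsBy.Exp (S.κ _ hA) (S.κ _ hB) (S.κ _ hC₁) (S.κ _ hC₂) (S.κ _ hD₁)
      (S.κ _ hD₂) (S.κ _ hD₃) (S.κ _ hD₄) (S.κ _ hE) (S.κ _ hF) (S.κ _ hT) := by
    have t (v : Additive S.K) : (((3 : ℤ) • v).toMul : G) = (v.toMul : G) ^ 3 := by
      rw [toMul_zsmul]; push_cast; exact zpow_natCast _ 3
    constructor <;> refine S.ext_K ?_ <;> rw [t]
    exacts [S.a3_pow, S.b3_pow, S.c₁_pow, S.c₂_pow, S.d₁_pow, S.d₂_pow, S.d₃_pow, S.d₄_pow,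
      S.ε_pow, S.η_pow, S.θ_pow]
  constructor
  · intro z hz
    induction hz using Subgroup.closure_induction with
    | mem z hz =>
      have key (x : G) (hx : x ∈ S.K) (h0 : nrm (S.σ y) (S.κ x hx) = 0) : norm₃ y x = 1 := by
        rw [← S.κ_toMul x hx, ← nrm_toMul, h0]; rfl
      have := h.nrm_eq_zero e
      simp only [Set.mem_insert_iff, Set.mem_singleton_iff, forall_eq_or_imp, forall_eq] at this
      obtain ⟨h₁, h₂, h₃, h₄, h₅, h₆, h₇, h₈, h₉, h₀⟩ := this
      exact (S.forall_gen₀ (p := fun z => norm₃ y z = 1)).2 ⟨key _ _ h₁, key _ _ h₂, key _ _ h₃, key _ _ h₄, key _ _ h₅,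
        key _ _ h₆, key _ _ h₇, key _ _ h₈, key _ _ h₉, key _ _ h₀⟩ z hz
    | one => simp [norm₃]
    | mul x z hx hz ihx ihz => rw [S.norm₃_mul y (S.K₀_le hx) (S.K₀_le hz), ihx, ihz, one_mul]
    | inv x hx ih =>
      have := S.norm₃_mul y (S.K₀_le hx) (S.K₀_le (inv_mem hx))
      rw [mul_inv_cancel, ih, one_mul] at this
      rw [← this]; simp [norm₃]
  · refine ⟨i, i * j, j ^ 2, ?_⟩
    have := congrArg (fun v : Additive S.K => (v.toMul : G)) (h.nrm_C₂ e)
    simp only [nrm_toMul, κ_toMul] at this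
    rw [this]; rfl

theorem norm₃_K₀ (y : G) {z : G} (hz : z ∈ S.K₀) : norm₃ y z = 1 := (S.norm₃_K y).1 z hz

/-- The normal form modulo `K₀`. -/
theorem exists_normal_form (x : G) :
    ∃ j i k m : ℕ, ∃ z ∈ S.K₀, x = S.a₂ ^ j * S.a₁ ^ i * S.b ^ k * S.c₂ ^ m * z := by
  suffices h : ∃ j i k m : ℕ, (x : G ⧸ S.K₀) =
      (S.a₂ ^ j * S.a₁ ^ i * S.b ^ k * S.c₂ ^ m : G) by
    obtain ⟨j, i, k, m, h⟩ := h
    exact ⟨j, i, k, m, _, QuotientGroup.eq.1 h.symm, (mul_inv_cancel_left _ _).symm⟩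
  obtain ⟨-, -, h₃, h₄, h₅, h₆, h₇, h₈, h₉, h₀⟩ := S.mem_gen₀
  let q : G →* G ⧸ S.K₀ := QuotientGroup.mk' S.K₀
  have q1 (z : G) (hz : z ∈ S.K₀) : q z = 1 := (QuotientGroup.eq_one_iff z).2 hz
  have hba : Commute (q S.a₁) (q S.b) := cj_eq_iff.1 (by
    rw [← map_cj, S.b_a₁, map_mul, q1 _ h₃, mul_one])
  have hca : Commute (q S.a₁) (q S.c₂) := cj_eq_iff.1 (by
    rw [← map_cj, S.c₂_a₁, map_mul, q1 _ h₆, mul_one])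
  have hc2 : Commute (q S.a₂) (q S.c₂) := cj_eq_iff.1 (by
    rw [← map_cj, S.c₂_a₂, map_mul, q1 _ h₇, mul_one])
  have hcb : Commute (q S.b) (q S.c₂) := cj_eq_iff.1 (by
    rw [← map_cj, S.c₂_b, map_mul, q1 _ (inv_mem h₉), mul_one])
  change ∃ j i k m : ℕ, q x = q (S.a₂ ^ j * S.a₁ ^ i * S.b ^ k * S.c₂ ^ m)
  simp only [map_mul, map_pow]
  refine S.induction_right (p := fun x => ∃ j i k m : ℕ,
    q x = q S.a₂ ^ j * q S.a₁ ^ i * q S.b ^ k * q S.c₂ ^ m) ⟨0, 0, 0, 0, by simp⟩ ?_ ?_ x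
  · rintro x ⟨j, i, k, m, h⟩
    refine ⟨j, i + 1, k, m, ?_⟩
    rw [map_mul, h, pow_succ]
    simp only [mul_assoc]
    rw [(hca.pow_right m).eq.symm, (hba.pow_right k).left_comm]
  · rintro x ⟨j, i, k, m, h⟩
    -- Moving a₂ to the left turns a₁^i into (a₁b)^i and b^k into (bc₂)^k; modulo `K₀` these factors
    -- commute.
    refine ⟨j + 1, i, i + k, k + m, ?_⟩
    have e (u : G ⧸ S.K₀) : u * q S.a₂ = q S.a₂ * cj (q S.a₂) u := by simp [cj_apply, mul_assoc]
    have h' : q x = q S.a₂ ^ j * (q S.a₁ ^ i * q S.b ^ k * q S.c₂ ^ m) := by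
      simpa only [mul_assoc] using h
    rw [map_mul, h', mul_assoc, e, map_mul, map_mul, map_pow, map_pow, map_pow,
      cj_of_commute hc2, ← map_cj, ← map_cj, S.a₁_a₂, S.b_a₂, map_mul, map_mul, hba.mul_pow,
      hcb.mul_pow, pow_succ, pow_add, pow_add]
    simp only [mul_assoc]

end Sys
end SemiAbelian

/-! ### The semi-3-abelian property. -/

namespace SemiAbelian

open Mono

/-- The collected data of the example group. -/
def exampleSys (n : ℕ) : Sys n (ExampleGroup n) :=
  (rel_of n).sys (PresentedGroup.closure_range_of _)

section Homs
variable {n : ℕ} {H : Type*} [Group H]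

theorem map_K₀_le (f : ExampleGroup n →* H) (L : Subgroup H)
    (ha : f (exampleSys n).a₁ ^ 3 ∈ L) (hb : f (exampleSys n).b ^ 3 ∈ L)
    (hc : f (exampleSys n).c₁ ∈ L) (hd : ∀ i j, f (wd PresentedGroup.of i j) ∈ L)
    (he : ∀ i j k, f (we PresentedGroup.of i j k) ∈ L) {z : ExampleGroup n}
    (hz : z ∈ (exampleSys n).K₀) : f z ∈ L := by
  have : (exampleSys n).K₀ ≤ L.comap f := by
    refine (Subgroup.closure_le _).2 ((exampleSys n).forall_gen₀ (p := fun z => z ∈ L.comap f) |>.2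
      ⟨?_, ?_, hc, hd _ _, hd _ _, hd _ _, hd _ _, he _ _ _, he _ _ _, he _ _ _⟩)
    · rwa [Subgroup.mem_comap, map_pow]
    · rwa [Subgroup.mem_comap, map_pow]
  exact this hz

theorem map_of_comm {A : Type*} [CommGroup A] (f : ExampleGroup n →* A)
    (h : f (exampleSys n).a₁ ^ 3 = 1) (j i k m : ℕ) {z : ExampleGroup n}
    (hz : z ∈ (exampleSys n).K₀) :
    f ((exampleSys n).a₂ ^ j * (exampleSys n).a₁ ^ i * (exampleSys n).b ^ k *
      (exampleSys n).c₂ ^ m * z) = f (exampleSys n).a₂ ^ j * f (exampleSys n).a₁ ^ i := by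
  have hc (u v : ExampleGroup n) : f (comm u v) = 1 := by
    rw [map_comm]; exact comm_eq_one_iff.2 (Commute.all _ _)
  have hb : f (exampleSys n).b = 1 := hc _ _
  have hc₂ : f (exampleSys n).c₂ = 1 := hc _ _
  have hK : f z ∈ (⊥ : Subgroup A) := map_K₀_le f ⊥ (by simp [h]) (by simp [hb])
    (Subgroup.mem_bot.2 (hc _ _)) (fun i j => Subgroup.mem_bot.2 (hc _ _))
    (fun i j k => Subgroup.mem_bot.2 (hc _ _)) hz
  rw [Subgroup.mem_bot] at hK
  simp [hb, hc₂, hK]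

theorem exists_hom_a₂ (n : ℕ) : ∃ φ : ExampleGroup n →* Multiplicative (ZMod (3 ^ n)),
    φ (exampleSys n).a₁ = 1 ∧ φ (exampleSys n).a₂ = .ofAdd 1 :=
  exists_hom_comm n 1 (Multiplicative.ofAdd (1 : ZMod (3 ^ n))) (by simp) (by
    rw [← ofAdd_nsmul, nsmul_one, ZMod.natCast_self]; rfl)

theorem exists_hom_a₁ (n : ℕ) : ∃ φ : ExampleGroup n →* Multiplicative (ZMod 9),
    φ (exampleSys n).a₁ = .ofAdd 1 ∧ φ (exampleSys n).a₂ = 1 :=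
  exists_hom_comm n (Multiplicative.ofAdd (1 : ZMod 9)) 1 (by decide) (by simp)

theorem three_dvd_of_ε_pow (hn : 2 ≤ n) {k u v : ℤ}
    (h : (exampleSys n).ε ^ k * (exampleSys n).η ^ u * (exampleSys n).θ ^ v = 1) : 3 ∣ k := by
  obtain ⟨μ, hμ⟩ := (rel_mono n hn).exists_hom
  have hc : μ ∘ PresentedGroup.of = ![M₁, M₂] := funext hμ
  have hε : μ (exampleSys n).ε = diag (.ofAdd (Me 1 0 0)) :=
    (map_we μ _ 1 0 0).trans (by rw [hc, we_mono])
  have hη : μ (exampleSys n).η = 1 := (map_we μ _ 1 1 0).trans (by rw [hc, we_mono]; rfl)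
  have hθ : μ (exampleSys n).θ = 1 := (map_we μ _ 1 1 1).trans (by rw [hc, we_mono]; rfl)
  have := congrArg μ h
  rw [map_mul, map_mul, map_zpow, map_zpow, map_zpow, hε, hη, hθ, one_zpow, one_zpow, mul_one, mul_one,
    map_one, ← map_zpow, ← ofAdd_zsmul, ← map_one diag] at this
  have := congrFun (diag_injective (f := k • Me 1 0 0) (g := 0) this) 0
  have h9 : ((k * 3 : ℤ) : ZMod 9) = 0 := by push_cast; simpa [Me] using this
  rw [ZMod.intCast_zmod_eq_zero_iff_dvd] at h9
  omega

end Homs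

theorem Mono.norm₃_diag {X A : Type*} [AddCommGroup A] (p : Mono X A) (f : X → A) :
    norm₃ p (diag (.ofAdd f)) =
      diag (.ofAdd fun t => f (p.perm (p.perm t)) + f (p.perm t) + f t) := by
  rw [norm₃, cj_diag, cj_diag, diag_mul, diag_mul, pow_two]; rfl

/-- The affine functions with coefficients divisible by three. -/
def affineThree : Subgroup (Mono (ZMod 9) (ZMod 9)) where
  carrier := {p | ∃ u v : ZMod 9, p = diag (.ofAdd fun t => 3 * (u * t + v))}
  one_mem' := ⟨0, 0, by simp [diag_zero]⟩
  mul_mem' := by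
    rintro _ _ ⟨u, v, rfl⟩ ⟨u', v', rfl⟩
    refine ⟨u + u', v + v', ?_⟩
    rw [diag_mul]; congr 2; funext t; simp only [Pi.add_apply]; ring
  inv_mem' := by
    rintro _ ⟨u, v, rfl⟩
    refine ⟨-u, -v, ?_⟩
    rw [← map_inv, ← ofAdd_neg]; congr 2; funext t; simp only [Pi.neg_apply]; ring

section Heis
variable {n : ℕ} {ψ : ExampleGroup n →* Mono (ZMod 9) (ZMod 9)}

theorem heis_b (hψ : ∀ i, ψ (PresentedGroup.of i) = heis i) :
    ψ (exampleSys n).b = diag (.ofAdd fun _ => 1) :=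
  (map_wb ψ _).trans (by rw [show ψ ∘ PresentedGroup.of = heis from funext hψ, wb_heis])

theorem heis_c (hψ : ∀ i, ψ (PresentedGroup.of i) = heis i) (i) :
    ψ (wc PresentedGroup.of i) = 1 :=
  (map_wc ψ _ _).trans (by rw [show ψ ∘ PresentedGroup.of = heis from funext hψ, wc_heis])

theorem heis_K₀ (hψ : ∀ i, ψ (PresentedGroup.of i) = heis i) {z : ExampleGroup n}
    (hz : z ∈ (exampleSys n).K₀) : ψ z ∈ affineThree := by
  have hd (i j) : ψ (wd PresentedGroup.of i j) = 1 := by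
    rw [wd, map_comm, heis_c hψ, comm_one_left]
  refine map_K₀_le ψ affineThree ?_ ?_ ?_ (fun i j => ?_) (fun i j k => ?_) hz
  · rw [show ψ (exampleSys n).a₁ = _ from hψ 0]
    refine ⟨1, 0, ?_⟩
    exact (diag_pow _ _).trans (ext_of_forall (by decide +kernel))
  · rw [heis_b hψ]
    refine ⟨0, 1, ?_⟩
    exact (diag_pow _ _).trans (ext_of_forall (by decide +kernel))
  · rw [show ψ (exampleSys n).c₁ = 1 from heis_c hψ 0]; exact one_mem _
  · rw [hd]; exact one_mem _
  · rw [we, map_comm, hd, comm_one_left]; exact one_mem _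

theorem heis_perm (hψ : ∀ i, ψ (PresentedGroup.of i) = heis i) (y : ExampleGroup n) :
    ∃ s, ∀ t, (ψ y).perm t = t + s := by
  refine (exampleSys n).induction (p := fun y => ∃ s, ∀ t, (ψ y).perm t = t + s) ⟨0, ?_⟩ ⟨0, ?_⟩
    ⟨1, ?_⟩ ?_ y
  · simp [one_perm]
  · rw [show ψ (exampleSys n).a₁ = _ from hψ 0]
    intro t; exact (add_zero t).symm
  · rw [show ψ (exampleSys n).a₂ = _ from hψ 1]
    intro t; rfl
  · rintro x y ⟨s, hs⟩ ⟨s', hs'⟩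
    exact ⟨s' + s, fun t => by rw [map_mul, mul_perm, Equiv.Perm.mul_apply, hs', hs, add_assoc]⟩

/-- In the Heisenberg quotient the argument of the norm is t ↦ it + k up to an affine function with
coefficients divisible by 3, and y translates by some s. The sum of the three translates is 3(it +
is + k) in ℤ/9. -/
theorem three_dvd_of_norm₃_eq_one (hn : 2 ≤ n) {y z : ExampleGroup n} {i k m : ℕ}
    (hz : z ∈ (exampleSys n).K₀) (h : norm₃ y ((exampleSys n).a₁ ^ i * (exampleSys n).b ^ k *
      (exampleSys n).c₂ ^ m * z) = 1) : 3 ∣ i ∧ 3 ∣ k := by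
  obtain ⟨ψ, hψ⟩ := (rel_heis hn).exists_hom
  obtain ⟨s, hs⟩ := heis_perm hψ y
  obtain ⟨u, v, hu⟩ := heis_K₀ hψ hz
  have := congrArg ψ h
  rw [map_norm₃, map_one, map_mul, map_mul, map_mul, map_pow, map_pow, map_pow,
    show ψ (exampleSys n).c₂ = 1 from heis_c hψ 1, one_pow, mul_one, hu, heis_b hψ,
    show ψ (exampleSys n).a₁ = diag (.ofAdd fun t => t) from hψ 0, diag_pow, diag_pow, diag_mul,
    diag_mul, norm₃_diag, ← map_one diag, ← ofAdd_zero] at this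
  have key := congrFun (diag_injective this)
  have h0 := key 0
  have h1 := key 1
  simp only [hs, Pi.add_apply, Pi.smul_apply, Pi.zero_apply] at h0 h1
  simp only [nsmul_eq_mul] at h0 h1
  have h9 : (9 : ZMod 9) = 0 := rfl
  have hi : ((i * 3 : ℕ) : ZMod 9) = 0 := by
    push_cast; linear_combination h1 - h0 - u * h9
  rw [ZMod.natCast_eq_zero_iff] at hi
  have hk : ((k * 3 : ℕ) : ZMod 9) = 0 := by
    have hi' : ((i * 3 : ℕ) : ZMod 9) = 0 := (ZMod.natCast_eq_zero_iff _ _).2 hi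
    push_cast at hi' ⊢
    linear_combination h0 - s * hi' - (u * s + v) * h9
  rw [ZMod.natCast_eq_zero_iff] at hk
  omega

end Heis

section Cubes
variable {n : ℕ}

theorem Sys.norm₃_pow {G : Type*} [Group G] (S : Sys n G) (y : G) {x : G} (hx : x ∈ S.K) (m : ℕ) :
    norm₃ y (x ^ m) = norm₃ y x ^ m := by
  induction m with
  | zero => simp [norm₃]
  | succ m ih => rw [pow_succ, S.norm₃_mul y (pow_mem hx m) hx, ih, pow_succ]

theorem Sys.c₂_pow_mem {G : Type*} [Group G] (S : Sys n G) {m : ℕ} (h : 3 ∣ m) :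
    S.c₂ ^ m ∈ S.K₀ := by
  obtain ⟨k, rfl⟩ := h
  rw [pow_mul, S.c₂_pow]
  exact pow_mem S.mem_gen₀.2.2.2.2.2.2.2.1 k

theorem Sys.a₁_pow_mem {G : Type*} [Group G] (S : Sys n G) {m : ℕ} (h : 3 ∣ m) :
    S.a₁ ^ m ∈ S.K₀ := by
  obtain ⟨k, rfl⟩ := h
  rw [pow_mul]
  exact pow_mem S.mem_gen₀.1 k

theorem Sys.b_pow_mem {G : Type*} [Group G] (S : Sys n G) {m : ℕ} (h : 3 ∣ m) :
    S.b ^ m ∈ S.K₀ := by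
  obtain ⟨k, rfl⟩ := h
  rw [pow_mul]
  exact pow_mem S.mem_gen₀.2.1 k

/-- The exponents of z in the normal form are controlled in turn: j in ℤ/3ⁿ, then i and k in the
Heisenberg quotient, then m through the power of ε in the norm. -/
theorem exists_of_norm₃_eq_one (hn : 3 ≤ n) {y z : ExampleGroup n} (h : norm₃ y z = 1) :
    ∃ ζ, (∀ x, Commute x ζ) ∧ ζ ^ 3 = 1 ∧ ∃ w ∈ (exampleSys n).K₀, z = ζ * w := by
  set S := exampleSys n with hS
  obtain ⟨j, i, k, m, w, hw, rfl⟩ := S.exists_normal_form z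
  obtain ⟨φ, hφ₁, hφ₂⟩ := exists_hom_a₂ n
  have hj : 3 ^ n ∣ 3 * j := by
    have := congrArg φ h
    rw [map_norm₃, norm₃, cj_of_commute (Commute.all _ _), cj_of_commute (Commute.all _ _),
      map_of_comm φ (by rw [hφ₁, one_pow]) j i k m hw, hφ₁, hφ₂, one_pow, mul_one, map_one φ,
      ← ofAdd_nsmul, ← ofAdd_add, ← ofAdd_add, ofAdd_eq_one, nsmul_one] at this
    rw [← ZMod.natCast_eq_zero_iff]
    push_cast; linear_combination this
  have hζ : ∀ x, Commute x (S.a₂ ^ j) := by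
    -- Here n ≥ 3 matters: 3ⁿ ∣ 3j gives 9 ∣ j, and a₂⁹ is central.
    have : 9 ∣ j := by
      obtain ⟨r, rfl⟩ := Nat.exists_eq_add_of_le hn
      rw [pow_add] at hj
      have : 3 ^ 3 ∣ 3 * j := (Dvd.intro _ rfl).trans hj
      omega
    obtain ⟨r, rfl⟩ := this
    intro x
    rw [pow_mul]
    exact ((S.commute_a₂_pow x).pow_left r).symm
  have hζ3 : (S.a₂ ^ j) ^ 3 = 1 := by
    rw [← pow_mul, mul_comm]
    obtain ⟨r, hr⟩ := hj
    rw [hr, pow_mul, S.a₂_pow, one_pow]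
  refine ⟨S.a₂ ^ j, hζ, hζ3, S.a₁ ^ i * S.b ^ k * S.c₂ ^ m * w, ?_, by simp only [mul_assoc]⟩
  have h' : norm₃ y (S.a₁ ^ i * S.b ^ k * S.c₂ ^ m * w) = 1 := by
    rw [← h, show S.a₂ ^ j * S.a₁ ^ i * S.b ^ k * S.c₂ ^ m * w =
      S.a₂ ^ j * (S.a₁ ^ i * S.b ^ k * S.c₂ ^ m * w) by simp only [mul_assoc],
      norm₃_mul_of_central hζ, hζ3, one_mul]
  obtain ⟨hi, hk⟩ := three_dvd_of_norm₃_eq_one (by omega) hw h'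
  have hab := mul_mem (S.a₁_pow_mem hi) (S.b_pow_mem hk)
  have hcm := pow_mem S.c₂_mem m
  obtain ⟨-, r, u, v, hc⟩ := S.norm₃_K y
  rw [S.norm₃_mul y (mul_mem (S.K₀_le hab) hcm) (S.K₀_le hw), S.norm₃_K₀ y hw, mul_one,
    S.norm₃_mul y (S.K₀_le hab) hcm, S.norm₃_K₀ y hab, one_mul, S.norm₃_pow y S.c₂_mem, hc,
    ((S.hθ _).zpow_right v).mul_pow, ((S.hη _).zpow_right u).mul_pow, ← zpow_natCast,
    ← zpow_natCast, ← zpow_natCast, ← zpow_mul, ← zpow_mul, ← zpow_mul] at h'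
  have h3 := three_dvd_of_ε_pow (by omega) h'
  have hm : 3 ∣ m := by
    -- -1 is not a square modulo 3.
    have hr : ¬ (3 : ℤ) ∣ 1 + r ^ 2 := by
      intro hr
      have : ((1 + r ^ 2 : ℤ) : ZMod 3) = 0 := (ZMod.intCast_zmod_eq_zero_iff_dvd _ _).2 hr
      push_cast at this
      generalize (r : ZMod 3) = s at this
      revert s; decide
    exact_mod_cast (Int.prime_three.dvd_or_dvd h3).resolve_left hr
  exact mul_mem (mul_mem hab (S.c₂_pow_mem hm)) hw

theorem isSemiAbelian_three (hn : 3 ≤ n) : IsSemiAbelian 3 (ExampleGroup n) := by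
  rw [isSemiAbelian_three_iff]
  have key (y y' z : ExampleGroup n) (h : norm₃ y z = 1) : norm₃ y' z = 1 := by
    obtain ⟨ζ, hζ, hζ3, w, hw, rfl⟩ := exists_of_norm₃_eq_one hn h
    rw [norm₃_mul_of_central hζ, hζ3, (exampleSys n).norm₃_K₀ y' hw, one_mul]
  intro y z
  rw [← norm₃_one_left]
  exact ⟨key y 1 z, key 1 y z⟩

end Cubes
end SemiAbelian

/-! ### Ninth powers, finiteness and maximal subgroups. -/

namespace SemiAbelian

open Mono

section Wreath
variable {n : ℕ} {π : ExampleGroup n →* Mono (ZMod 3) (ZMod 3)}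

theorem wreath_words (hπ : ∀ i, π (PresentedGroup.of i) = wreath i) :
    π (exampleSys n).b = diag (.ofAdd fun t => t) ∧ π (exampleSys n).c₁ = 1 ∧
      π (exampleSys n).c₂ = diag (.ofAdd fun _ => 1) := by
  have h : π ∘ PresentedGroup.of = wreath := funext hπ
  exact ⟨(map_wb π _).trans (by rw [h, wb_wreath]),
    (map_wc π _ _).trans (by rw [h, wc_wreath_zero]),
    (map_wc π _ _).trans (by rw [h, wc_wreath_one])⟩

theorem wreath_K₀ (hπ : ∀ i, π (PresentedGroup.of i) = wreath i) {z : ExampleGroup n}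
    (hz : z ∈ (exampleSys n).K₀) : π z = 1 := by
  have h : π ∘ PresentedGroup.of = wreath := funext hπ
  have hd (i j) : π (wd PresentedGroup.of i j) = 1 :=
    (map_wd π _ _ _).trans (by rw [h, wd_wreath])
  obtain ⟨hb, hc, -⟩ := wreath_words hπ
  rw [← Subgroup.mem_bot]
  refine map_K₀_le π ⊥ ?_ ?_ (Subgroup.mem_bot.2 hc) (fun i j => Subgroup.mem_bot.2 (hd i j))
    (fun i j k => ?_) hz <;> rw [Subgroup.mem_bot]
  · rw [show π (exampleSys n).a₁ = _ from hπ 0]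
    exact (diag_pow _ _).trans (ext_of_forall (by decide +kernel))
  · rw [hb]
    exact (diag_pow _ _).trans (ext_of_forall (by decide +kernel))
  · rw [we, map_comm, hd, comm_one_left]

theorem wreath_normal_form (hπ : ∀ i, π (PresentedGroup.of i) = wreath i) (j i k m : ℕ)
    {z : ExampleGroup n} (hz : z ∈ (exampleSys n).K₀) :
    π ((exampleSys n).a₂ ^ j * (exampleSys n).a₁ ^ i * (exampleSys n).b ^ k *
      (exampleSys n).c₂ ^ m * z) = shift _ (.ofAdd (j : ZMod 3)) *
        diag (.ofAdd fun t : ZMod 3 => i * (2 * t * (t - 1)) + k * t + m) := by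
  obtain ⟨hb, -, hc⟩ := wreath_words hπ
  rw [map_mul, map_mul, map_mul, map_mul, map_pow, map_pow, map_pow, map_pow, wreath_K₀ hπ hz,
    show π (exampleSys n).a₁ = diag (.ofAdd fun t : ZMod 3 => 2 * t * (t - 1)) from hπ 0,
    show π (exampleSys n).a₂ = shift (ZMod 3) (.ofAdd (1 : ZMod 3)) from hπ 1, hb, hc, mul_one, shift_pow, diag_pow,
    diag_pow, diag_pow, mul_assoc, mul_assoc, diag_mul, diag_mul, nsmul_one]
  congr 3
  funext t
  simp only [Pi.add_apply, Pi.smul_apply, add_assoc]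
  simp only [nsmul_eq_mul, mul_one]

end Wreath

theorem sum_quadratic (i j k m t : ZMod 3) :
    i * (2 * (t + j + j) * (t + j + j - 1)) + k * (t + j + j) + m +
      (i * (2 * (t + j) * (t + j - 1)) + k * (t + j) + m) + (i * (2 * t * (t - 1)) + k * t + m) =
        i * j ^ 2 := by
  have t3 : (3 : ZMod 3) = 0 := rfl
  linear_combination (i * (2 * t ^ 2 + 4 * t * j + 3 * j ^ 2 - 2 * t - 2 * j) + k * (t + j) + m) * t3

theorem quadratic_eq_const : ∀ i k m c : ZMod 3,
    (∀ t, i * (2 * t * (t - 1)) + k * t + m = c) → i = 0 ∧ k = 0 ∧ m = c := by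
  decide +kernel

/-- The ninth power of an element in terms of its exponents `i`, `j` in `a₁`, `a₂`. -/
theorem pow_nine_normal_form {n : ℕ} (hn : 1 ≤ n) (j i k m : ℕ) {z : ExampleGroup n}
    (hz : z ∈ (exampleSys n).K₀) :
    ((exampleSys n).a₂ ^ j * (exampleSys n).a₁ ^ i * (exampleSys n).b ^ k *
      (exampleSys n).c₂ ^ m * z) ^ 9 =
        (exampleSys n).a₂ ^ (9 * j) * (exampleSys n).ε ^ (i * j ^ 2) := by
  set S := exampleSys n with hS
  set x := S.a₂ ^ j * S.a₁ ^ i * S.b ^ k * S.c₂ ^ m * z with hx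
  obtain ⟨π, hπ⟩ := (rel_wreath hn).exists_hom
  obtain ⟨φ, hφ₁, hφ₂⟩ := exists_hom_a₂ n
  have hφ (j i k m : ℕ) {z : ExampleGroup n} (hz : z ∈ S.K₀) :
      φ (S.a₂ ^ j * S.a₁ ^ i * S.b ^ k * S.c₂ ^ m * z) = .ofAdd (j : ZMod (3 ^ n)) := by
    rw [map_of_comm φ (by rw [hφ₁, one_pow]) j i k m hz, hφ₁, hφ₂, one_pow, mul_one, ← ofAdd_nsmul,
      nsmul_one]
  -- The normal form of a₂^{-3j}x³: the map `φ` shows a₂^{j'} = 1, and the wreath product determines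
  -- i', k', m' modulo 3.
  obtain ⟨j', i', k', m', w, hw, hu⟩ := S.exists_normal_form ((S.a₂ ^ (3 * j))⁻¹ * x ^ 3)
  have hj' : S.a₂ ^ j' = 1 := by
    have := congrArg φ hu
    rw [hφ _ _ _ _ hw, map_mul, map_inv, map_pow φ x, hx, hφ _ _ _ _ hz, map_pow, hφ₂,
      ← ofAdd_nsmul, ← ofAdd_nsmul, ← ofAdd_neg, ← ofAdd_add, nsmul_one, nsmul_eq_mul,
      Nat.cast_mul, neg_add_cancel] at this
    have h0 : ((j' : ℕ) : ZMod (3 ^ n)) = 0 := (Multiplicative.ofAdd.injective this).symm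
    rw [ZMod.natCast_eq_zero_iff] at h0
    obtain ⟨r, hr⟩ := h0
    rw [hr, pow_mul, S.a₂_pow, one_pow]
  -- In C₃ ≀ C₃ the image of x³ is the norm of a quadratic function under translation by j, namely
  -- the constant ij².
  have hP : 3 ∣ i' ∧ 3 ∣ k' ∧ ((m' : ℕ) : ZMod 3) = i * j ^ 2 := by
    have := congrArg π hu
    have h3 : π (S.a₂ ^ (3 * j)) = 1 := by
      rw [map_pow, show π S.a₂ = shift (ZMod 3) (.ofAdd (1 : ZMod 3)) from hπ 1, pow_mul, shift_pow,
        show 3 • (1 : ZMod 3) = 0 from rfl, ofAdd_zero, map_one, one_pow]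
    have h3' : (shift (ZMod 3) (.ofAdd (j : ZMod 3))) ^ 3 = 1 := by
      rw [shift_pow, nsmul_eq_mul, show ((3 : ℕ) : ZMod 3) = 0 from rfl, zero_mul, ofAdd_zero,
        map_one]
    rw [hj', ← pow_zero S.a₂, wreath_normal_form hπ _ _ _ _ hw, map_mul, map_inv, h3, map_pow, hx,
      wreath_normal_form hπ _ _ _ _ hz, inv_one, one_mul, Nat.cast_zero, ofAdd_zero, map_one,
      one_mul, mul_pow_three_eq, h3', one_mul, norm₃_diag] at this
    have key := congrFun (diag_injective this)
    simp only [shift_perm] at key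
    rw [← ZMod.natCast_eq_zero_iff, ← ZMod.natCast_eq_zero_iff]
    refine quadratic_eq_const _ _ _ _ fun t => ?_
    rw [← key, sum_quadratic]
  obtain ⟨hi, hk, hm⟩ := hP
  have hw' : S.a₁ ^ i' * S.b ^ k' ∈ S.K₀ := mul_mem (S.a₁_pow_mem hi) (S.b_pow_mem hk)
  have hcm := pow_mem S.c₂_mem m'
  have hx3 : x ^ 3 = S.a₂ ^ (3 * j) * (S.a₁ ^ i' * S.b ^ k' * S.c₂ ^ m' * w) := by
    rw [← inv_mul_eq_iff_eq_mul, hu, hj', one_mul]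
  have hK : S.a₁ ^ i' * S.b ^ k' * S.c₂ ^ m' * w ∈ S.K :=
    mul_mem (mul_mem (S.K₀_le hw') hcm) (S.K₀_le hw)
  have hε : S.ε ^ m' = S.ε ^ (i * j ^ 2) := by
    rw [pow_eq_pow_iff_modEq]
    refine Nat.ModEq.of_dvd (orderOf_dvd_of_pow_eq_one S.ε_pow) ?_
    rw [← ZMod.natCast_eq_natCast_iff, hm]
    push_cast; rfl
  -- Since a₂³ centralizes the abelian group `K`, the factors can be cubed separately; cubing kills
  -- `K₀` and leaves c₂^{3m'} = ε^{m'}.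
  rw [show 9 = 3 * 3 from rfl, pow_mul, hx3, pow_mul S.a₂ 3 j,
    ((S.commute_a₂3_K hK).pow_left j).mul_pow,
    (S.commute_K (mul_mem (S.K₀_le hw') hcm) (S.K₀_le hw)).mul_pow,
    (S.commute_K (S.K₀_le hw') hcm).mul_pow, S.pow_of_mem_K₀ hw, S.pow_of_mem_K₀ hw', one_mul,
    mul_one, ← pow_mul S.c₂, mul_comm m', pow_mul S.c₂, S.c₂_pow, hε, ← pow_mul, ← pow_mul]
  congr 2
  ring

theorem exists_exponents {n : ℕ} (hn : 1 ≤ n) (x : ExampleGroup n) : ∃ i j : ℕ,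
    x ^ 9 = (exampleSys n).a₂ ^ (9 * j) * (exampleSys n).ε ^ (i * j ^ 2) ∧
    ∀ (A : Type) [CommGroup A] (f : ExampleGroup n →* A), f (exampleSys n).a₁ ^ 3 = 1 →
      f x = f (exampleSys n).a₂ ^ j * f (exampleSys n).a₁ ^ i := by
  obtain ⟨j, i, k, m, z, hz, rfl⟩ := (exampleSys n).exists_normal_form x
  exact ⟨i, j, pow_nine_normal_form hn j i k m hz, fun A _ f hf => map_of_comm f hf j i k m hz⟩

instance (n : ℕ) : Finite (ExampleGroup n) := by
  set S := exampleSys n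
  have hK : (S.K₀ : Set (ExampleGroup n)).Finite := by
    have : IsMulCommutative S.K₀ := Subgroup.isMulCommutative_closure fun x hx y hy =>
      S.commute_gens x (Set.mem_insert_of_mem _ hx) y (Set.mem_insert_of_mem _ hy)
    have : Group.FG S.K₀ := (Group.fg_iff_subgroup_fg _).2
      (Subgroup.fg_iff _ |>.2 ⟨S.gen₀, rfl, by simp [Sys.gen₀]⟩)
    open scoped IsMulCommutative in
    exact CommGroup.finite_of_fg_isMulTorsion S.K₀ fun x => isOfFinOrder_iff_pow_eq_one.2
      ⟨3, by norm_num, Subtype.ext (S.pow_of_mem_K₀ x.2)⟩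
  have ha₁ := (isOfFinOrder_iff_pow_eq_one.2 ⟨9, by norm_num, S.a₁_pow⟩).finite_powers
  have ha₂ := (isOfFinOrder_iff_pow_eq_one.2 ⟨3 ^ n, by positivity, S.a₂_pow⟩).finite_powers
  have hb := (isOfFinOrder_iff_pow_eq_one.2 ⟨9, by norm_num, S.b_pow⟩).finite_powers
  have hc : S.c₂ ^ 9 = 1 := by rw [show 9 = 3 * 3 from rfl, pow_mul, S.c₂_pow, S.ε_pow]
  have hc := (isOfFinOrder_iff_pow_eq_one.2 ⟨9, by norm_num, hc⟩).finite_powers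
  refine Set.finite_univ_iff.1 (((((ha₂.mul ha₁).mul hb).mul hc).mul hK).subset fun x _ => ?_)
  obtain ⟨j, i, k, m, z, hz, rfl⟩ := S.exists_normal_form x
  exact Set.mul_mem_mul (Set.mul_mem_mul (Set.mul_mem_mul (Set.mul_mem_mul ⟨j, rfl⟩ ⟨i, rfl⟩)
    ⟨k, rfl⟩) ⟨m, rfl⟩) hz

/-- A proper subgroup of a finite `p`-group lies in the kernel of a nontrivial homomorphism to a
commutative group of exponent `p`. -/
theorem IsPGroup.exists_hom_of_ne_top {p : ℕ} [Fact p.Prime] {G : Type} [Group G] [Finite G]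
    (hG : IsPGroup p G) {H : Subgroup G} (hH : H ≠ ⊤) :
    ∃ (A : Type) (_ : CommGroup A) (f : G →* A), (∀ a : A, a ^ p = 1) ∧ (∃ x, f x ≠ 1) ∧
      ∀ x ∈ H, f x = 1 := by
  obtain ⟨N, hN⟩ := IsPGroup.iff_card.1 hG
  obtain ⟨m, hm⟩ := IsPGroup.iff_card.1 (hG.to_subgroup H)
  have hlt : Nat.card H < Nat.card G :=
    (Subgroup.card_le_card_group H).lt_of_ne fun h => hH (Subgroup.eq_top_of_card_eq H h)
  have hp := (Fact.out : p.Prime)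
  rw [hN, hm, Nat.pow_lt_pow_iff_right hp.one_lt] at hlt
  obtain ⟨N, rfl⟩ := Nat.exists_eq_succ_of_ne_zero (Nat.ne_zero_of_lt hlt)
  -- Enlarge H to a subgroup of index p; it is normal, as p is the least prime factor of the group
  -- order.
  obtain ⟨K, hK, hHK⟩ := Sylow.exists_subgroup_card_pow_prime_le p
    (hN ▸ pow_dvd_pow p N.le_succ) H hm (Nat.lt_succ_iff.1 hlt)
  have hindex : K.index = p := by
    have := K.card_mul_index
    rw [hK, hN, pow_succ] at this
    exact Nat.eq_of_mul_eq_mul_left (by have := hp.pos; positivity) this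
  have hnormal : K.Normal := Subgroup.normal_of_index_eq_minFac_card (by
    rw [hindex, hN, hp.pow_minFac (Nat.succ_ne_zero N)])
  have hcyc : IsCyclic (G ⧸ K) := isCyclic_of_prime_card (p := p) hindex
  refine ⟨G ⧸ K, IsCyclic.commGroup, QuotientGroup.mk' K, fun a => ?_, ?_, fun x hx => ?_⟩
  · rw [← hindex]; exact pow_card_eq_one'
  · by_contra! h
    have : K = ⊤ := (Subgroup.eq_top_iff' K).2 fun x => (QuotientGroup.eq_one_iff x).1 (h x)
    rw [this, Subgroup.index_top] at hindex
    exact hp.one_lt.ne hindex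
  · exact (QuotientGroup.eq_one_iff x).2 (hHK hx)

/-! ### The semi-9-abelian property. -/

section Ninth
variable {n : ℕ}

theorem dvd_of_a₂_mul_ε (hn : 2 ≤ n) {k l : ℕ}
    (h : (exampleSys n).a₂ ^ k * (exampleSys n).ε ^ l = 1) : 3 ^ n ∣ k ∧ 3 ∣ l := by
  obtain ⟨φ, hφ₁, hφ₂⟩ := exists_hom_a₂ n
  have hk : 3 ^ n ∣ k := by
    have hε : φ (exampleSys n).ε = 1 :=
      (map_comm φ _ _).trans (comm_eq_one_iff.2 (Commute.all _ _))
    have := congrArg φ h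
    rw [map_mul, map_pow, map_pow, hφ₂, hε, one_pow, mul_one, map_one φ, ← ofAdd_nsmul, nsmul_one,
      ofAdd_eq_one, ZMod.natCast_eq_zero_iff] at this
    exact this
  refine ⟨hk, ?_⟩
  obtain ⟨r, rfl⟩ := hk
  rw [pow_mul, (exampleSys n).a₂_pow, one_pow, one_mul] at h
  have := three_dvd_of_ε_pow hn (k := l) (u := 0) (v := 0) (by simpa using h)
  exact_mod_cast this

theorem pow_eq_one_of_three_dvd {l : ℕ} (h : 3 ∣ l) : (exampleSys n).ε ^ l = 1 := by
  obtain ⟨r, rfl⟩ := h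
  rw [pow_mul, (exampleSys n).ε_pow, one_pow]

theorem isPGroup_exampleGroup (hn : 1 ≤ n) : IsPGroup 3 (ExampleGroup n) := by
  intro x
  obtain ⟨i, j, hx, -⟩ := exists_exponents hn x
  refine ⟨2 + (n + 1), ?_⟩
  have h : (exampleSys n).a₂ ^ 3 ^ (n + 1) = 1 := by
    rw [pow_succ, pow_mul, (exampleSys n).a₂_pow, one_pow]
  rw [pow_add, pow_mul, show 3 ^ 2 = 9 from rfl, hx, (((exampleSys n).hε _).pow_right _).mul_pow,
    pow_right_comm, h, one_pow, one_mul, ← pow_mul,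
    pow_eq_one_of_three_dvd (Dvd.dvd.mul_left (dvd_pow_self 3 n.succ_ne_zero) _)]

/-- Realizing i mod 3 and j mod 3ⁿ as values of homomorphisms makes the exponents additive under
products. -/
theorem exists_exponents_mod (hn : 1 ≤ n) : ∃ (α : ExampleGroup n →* Multiplicative (ZMod 3))
    (φ : ExampleGroup n →* Multiplicative (ZMod (3 ^ n))),
    α (exampleSys n).a₁ = .ofAdd 1 ∧ α (exampleSys n).a₂ = 1 ∧
    φ (exampleSys n).a₁ = 1 ∧ φ (exampleSys n).a₂ = .ofAdd 1 ∧
    ∀ x, ∃ i j : ℕ, α x = .ofAdd (i : ZMod 3) ∧ φ x = .ofAdd (j : ZMod (3 ^ n)) ∧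
      x ^ 9 = (exampleSys n).a₂ ^ (9 * j) * (exampleSys n).ε ^ (i * j ^ 2) ∧
      ∀ (A : Type) [CommGroup A] (f : ExampleGroup n →* A), f (exampleSys n).a₁ ^ 3 = 1 →
        f x = f (exampleSys n).a₂ ^ j * f (exampleSys n).a₁ ^ i := by
  obtain ⟨α, hα₁, hα₂⟩ := exists_hom_comm n (Multiplicative.ofAdd (1 : ZMod 3)) 1 (by decide)
    (by simp)
  obtain ⟨φ, hφ₁, hφ₂⟩ := exists_hom_a₂ n
  change α (exampleSys n).a₁ = _ at hα₁
  change α (exampleSys n).a₂ = _ at hα₂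
  refine ⟨α, φ, hα₁, hα₂, hφ₁, hφ₂, fun x => ?_⟩
  obtain ⟨i, j, hx, hf⟩ := exists_exponents hn x
  refine ⟨i, j, ?_, ?_, hx, hf⟩
  · rw [hf _ α (by rw [hα₁]; rfl), hα₁, hα₂, one_pow, one_mul, ← ofAdd_nsmul, nsmul_one]
  · rw [hf _ φ (by rw [hφ₁, one_pow]), hφ₁, hφ₂, one_pow, mul_one, ← ofAdd_nsmul, nsmul_one]

theorem not_isSemiAbelian_nine (hn : 2 ≤ n) : ¬ IsSemiAbelian (3 ^ 2) (ExampleGroup n) := by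
  intro h
  obtain ⟨α, φ, hα₁, hα₂, hφ₁, hφ₂, H⟩ := exists_exponents_mod (n := n) (by omega)
  set S := exampleSys n
  -- The product of this pair is a₁, of order 9, while a₁a₂⁻¹ has i = 1 and j = -1, so that ij² = 1
  -- modulo 3.
  have h9 := (h (S.a₁ * S.a₂⁻¹) S.a₂).1 (by rw [inv_mul_cancel_right]; exact S.a₁_pow)
  obtain ⟨i, j, hi, hj, hx, -⟩ := H (S.a₁ * S.a₂⁻¹)
  rw [show 3 ^ 2 = 9 from rfl, hx, mul_assoc, ← ((S.hε (S.a₂ ^ 9)).pow_right _).eq, ← mul_assoc,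
    ← pow_add] at h9
  have hd := (dvd_of_a₂_mul_ε hn h9).2
  rw [map_mul, map_inv, hα₁, hα₂, inv_one, mul_one, Multiplicative.ofAdd.apply_eq_iff_eq] at hi
  rw [map_mul, map_inv, hφ₁, hφ₂, one_mul, ← ofAdd_neg, Multiplicative.ofAdd.apply_eq_iff_eq] at hj
  have hj' : ((j + 1 : ℕ) : ZMod (3 ^ n)) = 0 := by push_cast; rw [← hj]; ring
  rw [ZMod.natCast_eq_zero_iff] at hj'
  have hj3 := (dvd_pow_self 3 (by omega : n ≠ 0)).trans hj'
  rw [← ZMod.natCast_eq_zero_iff] at hd hj3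
  push_cast at hd hj3
  rw [← hi, eq_neg_of_add_eq_zero_left hj3] at hd
  revert hd; decide

theorem pow_nine_eq_one_iff (hn : 3 ≤ n) (i j : ℕ) :
    (exampleSys n).a₂ ^ (9 * j) * (exampleSys n).ε ^ (i * j ^ 2) = 1 ↔ 3 ^ n ∣ 9 * j := by
  refine ⟨fun h => (dvd_of_a₂_mul_ε (by omega) h).1, fun h => ?_⟩
  have hj : 3 ∣ j := by
    have := (pow_dvd_pow 3 hn).trans h
    omega
  obtain ⟨r, hr⟩ := h
  rw [hr, pow_mul, (exampleSys n).a₂_pow, one_pow, one_mul,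
    pow_eq_one_of_three_dvd (Dvd.dvd.mul_left (dvd_pow hj two_ne_zero) _)]

/-- A nontrivial homomorphism that kills H gives a linear relation mod 3 between the exponents of
its elements. When 3ⁿ ∣ 9(j + j'), this relation forces 3 ∣ ij² + i'j'², so the conditions on (xy)⁹
and on x⁹y⁹ both reduce to 3ⁿ ∣ 9(j + j'). -/
theorem isSemiAbelian_nine_of_ne_top (hn : 3 ≤ n) {H : Subgroup (ExampleGroup n)} (hH : H ≠ ⊤) :
    IsSemiAbelian (3 ^ 2) H := by
  obtain ⟨A, _, f, hA, ⟨x₀, hx₀⟩, hf⟩ :=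
    IsPGroup.exists_hom_of_ne_top (p := 3) (isPGroup_exampleGroup (by omega)) hH
  obtain ⟨α, φ, -, -, -, -, hex⟩ := exists_exponents_mod (n := n) (by omega)
  have hne : ¬ (f (exampleSys n).a₁ = 1 ∧ f (exampleSys n).a₂ = 1) := by
    rintro ⟨h₁, h₂⟩
    obtain ⟨i, j, -, -, -, hx⟩ := hex x₀
    exact hx₀ (by rw [hx _ f (hA _), h₁, h₂, one_pow, one_pow, one_mul])
  rintro ⟨x, hx⟩ ⟨y, hy⟩
  rw [← Subtype.coe_inj, ← Subtype.coe_inj]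
  change (x * y) ^ 9 = 1 ↔ x ^ 9 * y ^ 9 = 1
  obtain ⟨i, j, hi, hj, hx9, hxf⟩ := hex x
  obtain ⟨i', j', hi', hj', hy9, hyf⟩ := hex y
  obtain ⟨i₂, j₂, hi₂, hj₂, hxy9, hxyf⟩ := hex (x * y)
  rw [map_mul, hi, hi', ← ofAdd_add, Multiplicative.ofAdd.apply_eq_iff_eq] at hi₂
  rw [map_mul, hj, hj', ← ofAdd_add, Multiplicative.ofAdd.apply_eq_iff_eq, ← Nat.cast_add,
    ZMod.natCast_eq_natCast_iff] at hj₂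
  set S := exampleSys n
  have e : x ^ 9 * y ^ 9 = S.a₂ ^ (9 * (j + j')) * S.ε ^ (i * j ^ 2 + i' * j' ^ 2) := by
    rw [hx9, hy9, mul_assoc, ← mul_assoc (S.ε ^ _), ← ((S.hε _).pow_right _).eq, mul_add, pow_add,
      pow_add]
    simp only [mul_assoc]
  have e₂ : 3 ^ n ∣ 9 * j₂ ↔ 3 ^ n ∣ 9 * (j + j') := (hj₂.mul_left 9).symm.dvd_iff dvd_rfl
  rw [hxy9, pow_nine_eq_one_iff hn, e, e₂]
  refine ⟨fun h => ?_, fun h => (dvd_of_a₂_mul_ε (by omega) h).1⟩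
  have hjj : 3 ∣ j + j' := by
    have := (pow_dvd_pow 3 hn).trans h
    omega
  have hij : 3 ∣ i * j ^ 2 + i' * j' ^ 2 := by
    have hone (a : A) {m : ℕ} (hm : ¬ 3 ∣ m) (ha : a ^ m = 1) : a = 1 := by
      rw [← orderOf_eq_one_iff]
      exact Nat.eq_one_of_dvd_coprimes ((Nat.Prime.coprime_iff_not_dvd Nat.prime_three).2 hm)
        (orderOf_dvd_of_pow_eq_one (hA a)) (orderOf_dvd_of_pow_eq_one ha)
    have h₁ := (hxf _ f (hA _)).symm.trans (hf x hx)
    have h₂ := (hyf _ f (hA _)).symm.trans (hf y hy)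
    by_cases hj3 : 3 ∣ j
    · have hj3' : 3 ∣ j' := (Nat.dvd_add_right hj3).1 hjj
      exact dvd_add (Dvd.dvd.mul_left (dvd_pow hj3 two_ne_zero) _)
        (Dvd.dvd.mul_left (dvd_pow hj3' two_ne_zero) _)
    by_cases hi3 : 3 ∣ i + i'
    -- Here (i', j') = -(i, j) modulo 3, and the form ij² is odd.
    · rw [← ZMod.natCast_eq_zero_iff] at hjj hi3 ⊢
      push_cast at hjj hi3 ⊢
      rw [eq_neg_of_add_eq_zero_left hjj, eq_neg_of_add_eq_zero_left hi3]
      ring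
    -- In the remaining case adding the relations of x and y gives f(a₁)^{i+i'} = 1, hence f(a₁) =
    -- 1; then f(a₂)^j = 1 with 3 ∤ j makes f trivial.
    refine (hne ?_).elim
    have h₃ : f S.a₁ ^ (i + i') = 1 := by
      have h₄ : f S.a₂ ^ (j + j') = 1 := by
        obtain ⟨r, hr⟩ := hjj
        rw [hr, pow_mul, hA, one_pow]
      calc f S.a₁ ^ (i + i') = f S.a₂ ^ (j + j') * f S.a₁ ^ (i + i') := by rw [h₄, one_mul]
        _ = (f S.a₂ ^ j * f S.a₁ ^ i) * (f S.a₂ ^ j' * f S.a₁ ^ i') := by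
          rw [pow_add, pow_add, mul_mul_mul_comm]
        _ = 1 := by rw [h₁, h₂, one_mul]
    have hu := hone _ hi3 h₃
    rw [hu, one_pow, mul_one] at h₁
    exact ⟨hu, hone _ hj3 h₁⟩
  obtain ⟨r, hr⟩ := h
  rw [hr, pow_mul, S.a₂_pow, one_pow, one_mul, pow_eq_one_of_three_dvd hij]

theorem orderOf_a₁ (n : ℕ) : orderOf (exampleSys n).a₁ = 3 ^ 2 := by
  obtain ⟨α, hα, -⟩ := exists_hom_a₁ n
  refine orderOf_eq_prime_pow (fun h => ?_) (exampleSys n).a₁_pow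
  have := congrArg α h
  rw [map_pow, hα, map_one α] at this
  revert this; decide

theorem orderOf_a₂ (n : ℕ) : orderOf (exampleSys n).a₂ = 3 ^ n := by
  obtain ⟨φ, -, hφ⟩ := exists_hom_a₂ n
  refine Nat.dvd_antisymm (orderOf_dvd_of_pow_eq_one (exampleSys n).a₂_pow) ?_
  have := orderOf_map_dvd φ (exampleSys n).a₂
  rwa [hφ, orderOf_ofAdd_eq_addOrderOf, ZMod.addOrderOf_one] at this

end Ninth

end SemiAbelian

theorem mainTheorem1 :
    (∀ n : ℕ, 3 ≤ n →
      Finite (SemiAbelian.ExampleGroup n) ∧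
      IsPGroup 3 (SemiAbelian.ExampleGroup n) ∧
      orderOf (PresentedGroup.of 0 : SemiAbelian.ExampleGroup n) = 3 ^ 2 ∧
      orderOf (PresentedGroup.of 1 : SemiAbelian.ExampleGroup n) = 3 ^ n ∧
      SemiAbelian.IsSemiAbelian 3 (SemiAbelian.ExampleGroup n) ∧
      SemiAbelian.IsInnerSemiAbelian (3 ^ 2) (SemiAbelian.ExampleGroup n) ∧
      ¬ SemiAbelian.IsStronglySemiAbelian 3 (SemiAbelian.ExampleGroup n)) ∧
    ¬ (∀ (G : Type) [Group G] [Finite G], IsPGroup 3 G →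
        SemiAbelian.IsSemiAbelian 3 G → SemiAbelian.IsStronglySemiAbelian 3 G) := by
  have not_strong (n : ℕ) (hn : 3 ≤ n) :
      ¬ SemiAbelian.IsStronglySemiAbelian 3 (SemiAbelian.ExampleGroup n) := fun h =>
    SemiAbelian.not_isSemiAbelian_nine (by omega) (h 2 (by norm_num))
  refine ⟨fun n hn => ⟨inferInstance, SemiAbelian.isPGroup_exampleGroup (by omega),
    SemiAbelian.orderOf_a₁ n, SemiAbelian.orderOf_a₂ n, SemiAbelian.isSemiAbelian_three hn,
    ⟨fun H hH => SemiAbelian.isSemiAbelian_nine_of_ne_top hn hH,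
      SemiAbelian.not_isSemiAbelian_nine (by omega)⟩, not_strong n hn⟩, fun h => ?_⟩
  exact not_strong 3 le_rfl (h _ (SemiAbelian.isPGroup_exampleGroup (by omega))
    (SemiAbelian.isSemiAbelian_three le_rfl))
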